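/- For a positive integer $n$ write $[n]=\{1,\dots,n\}$. The set of subset sums of a finite set $A\subset\mathbb N$ is $\{\sum_{x\in S}x : S\subseteq A\}$. A set $A\subseteq[n]$ is non-averaging if no $a\in A$ is the average of two or more other (distinct) elements of $A$, that is, there is no $S\subseteq A\setminus\{a\}$ with $|S|\ge 2$ and $a=\frac1{|S|}\sum_{x\in S}x$. Let $H(n)$ be the largest integer $m$ for which there are two subsets of $[n]$, each of size $m$, whose sets of subset sums have no non-zero common element, and let $h(n)$ be the size of the largest non-averaging subset of $[n]$. There is an absolute constant $C>0$ such that, for every integer $n\ge 1$: 1. any two subsets $A,B\subseteq[n]$ with $|A|,|B|\ge C\sqrt n$ have a common non-zero subset sum; 2. $H(n)\le C\sqrt n$; 3. $h(n)\le 2H(n)+2$ (Straus' inequality); 4. $h(n)\le C\sqrt n$, that is, every non-averaging subset of $[n]$ has at most $C\sqrt n$ elements. -/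

import Mathlib

namespace NonAveraging

/-- The set of subset sums of `A`: all sums of distinct members of `A`
(the empty sum `0` included). -/
def subsetSums (A : Finset ℕ) : Set ℕ :=
  {s | ∃ S : Finset ℕ, S ⊆ A ∧ ∑ x ∈ S, x = s}

/-- `A` and `B` have a common non-zero subset sum. -/
def HaveCommonSum (A B : Finset ℕ) : Prop :=
  ∃ s : ℕ, s ≠ 0 ∧ s ∈ subsetSums A ∧ s ∈ subsetSums B

/-- No element of `A` is the average of two or more other elements of `A`. -/
def IsNonAveraging (A : Finset ℕ) : Prop :=
  ∀ a ∈ A, ¬ ∃ S : Finset ℕ, S ⊆ A.erase a ∧ 2 ≤ S.card ∧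
    (a : ℚ) = (∑ x ∈ S, (x : ℚ)) / (S.card : ℚ)

/-- The integers `m` for which there are two `m`-element subsets of `{1, …, n}` whose sets of
subset sums have no non-zero common element. -/
def disjointSumSizes (n : ℕ) : Set ℕ :=
  {m | ∃ A B : Finset ℕ, A ⊆ Finset.Icc 1 n ∧ B ⊆ Finset.Icc 1 n ∧
    A.card = m ∧ B.card = m ∧ ¬ HaveCommonSum A B}

/-- The sizes of the non-averaging subsets of `{1, …, n}`. -/
def nonAveragingSizes (n : ℕ) : Set ℕ :=
  {m | ∃ A : Finset ℕ, A ⊆ Finset.Icc 1 n ∧ A.card = m ∧ IsNonAveraging A}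

/-- `H(n)`, the largest element of `disjointSumSizes n` (see `isGreatest_bigH`). -/
noncomputable def bigH (n : ℕ) : ℕ := sSup (disjointSumSizes n)

/-- `h(n)`, the largest size of a non-averaging subset of `{1, …, n}`
(see `isGreatest_smallH`). -/
noncomputable def smallH (n : ℕ) : ℕ := sSup (nonAveragingSizes n)

/-- The supremum defining `bigH n` is a maximum. -/
theorem isGreatest_bigH (n : ℕ) : IsGreatest (disjointSumSizes n) (bigH n) := by
  have hb : BddAbove (disjointSumSizes n) := by
    refine ⟨n, ?_⟩
    rintro m ⟨A, B, hA, -, rfl, -, -⟩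
    simpa using Finset.card_le_card hA
  have hne : (disjointSumSizes n).Nonempty := by
    refine ⟨0, ∅, ∅, by simp, by simp, by simp, by simp, ?_⟩
    rintro ⟨s, hs, ⟨S, hS, rfl⟩, -⟩
    exact hs (by simp [Finset.subset_empty.mp hS])
  exact ⟨Nat.sSup_mem hne hb, fun m hm => le_csSup hb hm⟩

/-- The supremum defining `smallH n` is a maximum. -/
theorem isGreatest_smallH (n : ℕ) : IsGreatest (nonAveragingSizes n) (smallH n) := by
  have hb : BddAbove (nonAveragingSizes n) := by
    refine ⟨n, ?_⟩
    rintro m ⟨A, hA, rfl, -⟩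
    simpa using Finset.card_le_card hA
  have hne : (nonAveragingSizes n).Nonempty :=
    ⟨0, ∅, by simp, by simp, by intro a ha; simp at ha⟩
  exact ⟨Nat.sSup_mem hne hb, fun m hm => le_csSup hb hm⟩

end NonAveraging

/-! The core is that a set of at least C√n integers in [1, n] has among its subset sums all
multiples of some d in an interval of length 3dn (`exists_fills_zero`). Given two such sets, apply
this to the one of smaller total, say A. By Erdős–Ginzburg–Ziv, d-element subsets of B with sum
divisible by d can be joined one after another, each adding at most dn, so some sum from B lands in
the interval, unless fewer than 2d - 1 elements of B remain. In that case the total of B is below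
the top of A's progression, hence below the total of A, a contradiction (`Fills.haveCommonSum`).

The progression arises as follows. Two separated dense groups in a window of length D have a popular
difference q comparable to D, and disjoint pairs with that difference give a progression of
difference q. An energy bound makes popular sums plentiful, and a consequence of Olson's inequality
shows that they cover a large subgroup modulo q, which lowers the difference to O(√n)
(`exists_fills_of_separated`). Once a few elements are absorbed, the remaining ones share a residue
class and lengthen the progression quadratically (`exists_long_fills`). A second absorption leaves
only multiples of a new difference d'. Unless d' = 1, divide by d' and repeat with n / d'; the
losses form a geometric series (`exists_homogeneous`).

For a non-averaging set, the distances from a median to the elements below it and above it form two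
sets with no common non-zero subset sum, which is Straus' inequality. -/

namespace NonAveraging

open scoped Pointwise

/-! ### Sumset growth in finite abelian groups -/

/-- **Olson's inequality** for finite abelian groups. If `0 ∈ Y` generates `H` and `P ⊆ H` is such
that `P + Y ≠ H`, then adding `Y` enlarges `P` by at least `|Y| / 2`. -/
theorem card_add_two_mul_card_le {G : Type*} [AddCommGroup G] [Fintype G] [DecidableEq G]
    {Y P H : Finset G} (h0 : 0 ∈ Y) (hH : (H : Set G) = AddSubgroup.closure (Y : Set G))
    (hPH : P ⊆ H) (hP : P.Nonempty) (hne : P + Y ≠ H) :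
    Y.card + 2 * P.card ≤ 2 * (P + Y).card := by
  classical
  have memH : ∀ x, x ∈ H ↔ x ∈ AddSubgroup.closure (Y : Set G) := fun x => by
    simpa using Set.ext_iff.1 hH x
  have hYH : Y ⊆ H := fun y hy => (memH y).2 (AddSubgroup.subset_closure hy)
  have hadd : ∀ {x y}, x ∈ H → y ∈ H → x + y ∈ H := fun hx hy => by
    rw [memH] at *; exact add_mem hx hy
  have hneg : ∀ {x}, x ∈ H → -x ∈ H := fun hx => by
    rw [memH] at *; exact neg_mem hx
  have hsub : ∀ F : Finset G, F ⊆ F + Y := fun F => Finset.subset_add_left F h0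
  have hFY : ∀ F : Finset G, F ⊆ H → F + Y ⊆ H := fun F hF x hx => by
    obtain ⟨a, ha, b, hb, rfl⟩ := Finset.mem_add.1 hx
    exact hadd (hF ha) (hYH hb)
  -- Isoperimetric method: minimise the boundary size `g` over admissible sets; a minimiser of least
  -- cardinality (an atom) turns out to be a coset of a subgroup.
  set adm : Finset G → Prop := fun F => F ⊆ H ∧ F.Nonempty ∧ F + Y ≠ H with hadm
  set g : Finset G → ℕ := fun F => (F + Y).card - F.card with hg
  have hgadd : ∀ F, g F + F.card = (F + Y).card := fun F =>
    Nat.sub_add_cancel (Finset.card_le_card (hsub F))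
  -- The factor |G| + 1 makes this a lexicographic minimum: `g` first, then cardinality.
  obtain ⟨A, hA, hmin⟩ := Finset.exists_min_image (Finset.univ.filter adm)
    (fun F => g F * (Fintype.card G + 1) + F.card) ⟨P, by simp [hadm, hPH, hP, hne]⟩
  have hAadm : adm A := (Finset.mem_filter.1 hA).2
  have hcardG : ∀ F : Finset G, F.card ≤ Fintype.card G := Finset.card_le_univ
  have hmin1 : ∀ F, adm F → g A ≤ g F := fun F hF => by
    have := hmin F (by simp [hF])
    have h1 := hcardG F
    by_contra! hlt
    nlinarith
  have hmin2 : ∀ F, adm F → g F ≤ g A → A.card ≤ F.card := fun F hF hle => by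
    have := hmin F (by simp [hF])
    have h1 := le_antisymm hle (hmin1 F hF)
    simp only [h1] at this
    omega
  -- The reflected complement of A + Y is admissible with boundary no larger than that of A, so by
  -- minimality it has at least |A| elements.
  have hdual : A.card + (A + Y).card ≤ H.card := by
    set D : Finset G := -(H \ (A + Y)) with hD
    have hDH : D ⊆ H := fun x hx => by
      have := (Finset.mem_sdiff.1 (Finset.mem_neg'.1 hx)).1
      simpa using hneg this
    have hDc : D.card + (A + Y).card = H.card := by
      rw [hD, Finset.card_neg, Finset.card_sdiff_add_card_eq_card (hFY A hAadm.1)]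
    have hDY : D + Y ⊆ -(H \ A) := fun x hx => by
      obtain ⟨d, hd, y, hy, rfl⟩ := Finset.mem_add.1 hx
      have hd' := Finset.mem_sdiff.1 (Finset.mem_neg'.1 hd)
      rw [Finset.mem_neg', Finset.mem_sdiff]
      refine ⟨hneg (hadd (hDH hd) (hYH hy)), fun hmem => hd'.2 ?_⟩
      have := Finset.add_mem_add hmem hy
      simpa using this
    have hDYc : (D + Y).card + A.card ≤ H.card := by
      have := Finset.card_le_card hDY
      rw [Finset.card_neg] at this
      have h2 := Finset.card_sdiff_add_card_eq_card hAadm.1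
      omega
    have hApos := hAadm.2.1.card_pos
    have hDne : D.Nonempty := by
      rw [← Finset.card_pos]
      have : (A + Y).card < H.card :=
        Finset.card_lt_card ((hFY A hAadm.1).ssubset_of_ne hAadm.2.2)
      omega
    have hDadm : adm D := ⟨hDH, hDne, fun h => by rw [h] at hDYc; omega⟩
    have h1 := hgadd D
    have h2 := hgadd A
    have := hmin2 D hDadm (by omega)
    omega
  -- Submodularity of `g`: meeting atoms intersect in an atom, so they coincide. If the union
  -- already sums to H, `hdual` supplies the missing bound.
  have hatom : ∀ B, adm B → g B = g A → B.card = A.card → (A ∩ B).Nonempty → A = B := by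
    intro B hB hgB hcB hAB
    have hI : adm (A ∩ B) := by
      refine ⟨Finset.inter_subset_left.trans hAadm.1, hAB, fun h => hAadm.2.2 ?_⟩
      refine (hFY A hAadm.1).antisymm ?_
      rw [← h]
      exact Finset.add_subset_add_right Finset.inter_subset_left
    have hc1 : (A ∩ B).card + (A ∪ B).card = A.card + B.card :=
      Finset.card_inter_add_card_union A B
    have hc2 : ((A ∩ B) + Y).card + ((A ∪ B) + Y).card ≤ (A + Y).card + (B + Y).card := by
      rw [Finset.union_add, ← Finset.card_inter_add_card_union (A + Y) (B + Y)]
      exact Nat.add_le_add_right (Finset.card_le_card Finset.inter_add_subset) _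
    have hU : g A ≤ g (A ∪ B) := by
      by_cases h : (A ∪ B) + Y = H
      · have h1 := hgadd (A ∪ B)
        have h2 := hgadd A
        rw [h] at h1
        omega
      · exact hmin1 _ ⟨Finset.union_subset hAadm.1 hB.1, hAadm.2.1.mono Finset.subset_union_left, h⟩
    have h1 := hgadd (A ∪ B)
    have h2 := hgadd A
    have h3 := hgadd B
    have h4 := hgadd (A ∩ B)
    have h5 := hmin2 _ hI (by omega)
    have h6 : A ∩ B = A := Finset.eq_of_subset_of_card_le Finset.inter_subset_left h5
    exact Finset.eq_of_subset_of_card_le (Finset.inter_eq_left.1 h6) hcB.le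
  have htrans : ∀ a ∈ A, ∀ x ∈ A, (x - a) +ᵥ A = A := by
    intro a ha x hx
    have hxa : x - a ∈ H := by
      rw [sub_eq_add_neg]; exact hadd (hAadm.1 hx) (hneg (hAadm.1 ha))
    have hcY : ((x - a) +ᵥ A) + Y = (x - a) +ᵥ (A + Y) := vadd_add_assoc _ _ _
    have hcard : ((x - a) +ᵥ A).card = A.card := Finset.card_vadd_finset _ _
    refine (hatom _ ⟨?_, hAadm.2.1.vadd_finset, fun h => hAadm.2.2 ?_⟩ ?_ hcard ?_).symm
    · intro z hz
      obtain ⟨w, hw, rfl⟩ := Finset.mem_vadd_finset.1 hz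
      exact hadd hxa (hAadm.1 hw)
    · refine Finset.eq_of_subset_of_card_le (hFY A hAadm.1) ?_
      rw [← h, hcY, Finset.card_vadd_finset]
    · simp only [hg]
      rw [hcY, hcard, Finset.card_vadd_finset]
    · refine ⟨x, Finset.mem_inter.2 ⟨hx, Finset.mem_vadd_finset.2 ⟨a, ha, ?_⟩⟩⟩
      simp [vadd_eq_add]
  -- Otherwise the stabilizer of A contains Y, hence H, and A = H. Such a y puts two disjoint
  -- translates of A inside A + Y, so |A + Y| ≥ 2|A| and 2 `g` A ≥ |A + Y| ≥ |Y|.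
  obtain ⟨y, hy, a, ha, hya⟩ : ∃ y ∈ Y, ∃ a ∈ A, a + y ∉ A := by
    by_contra! hcon
    refine hAadm.2.2 ((hFY A hAadm.1).antisymm fun x hx => ?_)
    obtain ⟨a, ha⟩ := hAadm.2.1
    let K : AddSubgroup G :=
      { carrier := {t | t +ᵥ A = A}
        add_mem' := fun {s t} hs ht => by
          simp only [Set.mem_ofPred_eq] at *
          rw [add_vadd, ht, hs]
        zero_mem' := by simp
        neg_mem' := fun {s} hs => by
          simp only [Set.mem_ofPred_eq] at *
          rw [neg_vadd_eq_iff, hs] }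
    have hYK : AddSubgroup.closure (Y : Set G) ≤ K := by
      rw [AddSubgroup.closure_le]
      intro y hy
      have := htrans a ha (a + y) (hcon y hy a ha)
      simpa [K] using this
    have hxa : x - a ∈ K := hYK ((memH _).1 (by
      rw [sub_eq_add_neg]; exact hadd hx (hneg (hAadm.1 ha))))
    have : x ∈ A := by
      have h1 : (x - a) +ᵥ A = A := hxa
      rw [← h1]
      exact Finset.mem_vadd_finset.2 ⟨a, ha, by simp [vadd_eq_add]⟩
    exact hsub A this
  have hdisj : Disjoint A (y +ᵥ A) := by
    rw [Finset.disjoint_left]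
    intro x hx hx'
    obtain ⟨w, hw, rfl⟩ := Finset.mem_vadd_finset.1 hx'
    apply hya
    have := htrans w hw _ hx
    rw [← this]
    refine Finset.mem_vadd_finset.2 ⟨a, ha, ?_⟩
    simp only [vadd_eq_add]; abel
  have hle : 2 * A.card ≤ (A + Y).card := by
    have : A ∪ (y +ᵥ A) ⊆ A + Y := by
      refine Finset.union_subset (hsub A) fun x hx => ?_
      obtain ⟨w, hw, rfl⟩ := Finset.mem_vadd_finset.1 hx
      rw [vadd_eq_add, add_comm y w]
      exact Finset.add_mem_add hw hy
    have := Finset.card_le_card this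
    rw [Finset.card_union_of_disjoint hdisj, Finset.card_vadd_finset] at this
    omega
  have hYc : Y.card ≤ (A + Y).card := by
    obtain ⟨a, ha⟩ := hAadm.2.1
    rw [← Finset.card_vadd_finset a Y]
    refine Finset.card_le_card fun x hx => ?_
    obtain ⟨w, hw, rfl⟩ := Finset.mem_vadd_finset.1 hx
    exact Finset.add_mem_add ha hw
  have h1 := hmin1 P ⟨hPH, hP, hne⟩
  have h2 := hgadd P
  have h3 := hgadd A
  omega

/-- For a decreasing chain `Y 0 ⊇ Y 1 ⊇ ⋯` of sets containing `0`, the sum of some of the members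
covers a subgroup `H` which contains all of the other members, up to members of small total size. -/
theorem exists_subgroup_subset_sum {G : Type*} [AddCommGroup G] [Fintype G] [DecidableEq G]
    (N : ℕ) (Y : ℕ → Finset G) (h0 : ∀ i < N, 0 ∈ Y i)
    (hanti : ∀ i j, i ≤ j → j < N → Y j ⊆ Y i) :
    ∃ (J : Finset ℕ) (H : AddSubgroup G), J ⊆ Finset.range N ∧
      (∀ h ∈ H, ∃ y : ℕ → G, (∀ i ∈ J, y i ∈ Y i) ∧ ∑ i ∈ J, y i = h) ∧
      ∑ i ∈ Finset.range N, (Y i).card ≤ 2 * Fintype.card G + N * Nat.card H := by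
  classical
  have key : ∀ J : Finset ℕ, ∀ x ∈ ∑ i ∈ J, Y i,
      ∃ y : ℕ → G, (∀ i ∈ J, y i ∈ Y i) ∧ ∑ i ∈ J, y i = x := by
    intro J x hx
    rw [← Finset.mem_coe, Finset.coe_sum, Set.mem_finsetSum] at hx
    obtain ⟨y, hy, hxy⟩ := hx
    exact ⟨y, fun i hi => hy hi, hxy⟩
  -- A good family has sumset growth at least half the sum of its sizes, which bounds its total size
  -- by 2|G|.
  set good : Finset ℕ → Prop := fun J => ∑ i ∈ J, (Y i).card + 2 ≤ 2 * (∑ i ∈ J, Y i).card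
  obtain ⟨J, hJ, hmax⟩ := Finset.exists_max_image ((Finset.range N).powerset.filter good)
    Finset.card ⟨∅, by simp [good]⟩
  obtain ⟨hJN, hJg⟩ := Finset.mem_filter.1 hJ
  rw [Finset.mem_powerset] at hJN
  have hJg' : ∑ i ∈ J, (Y i).card ≤ 2 * Fintype.card G := by
    have := Finset.card_le_univ (∑ i ∈ J, Y i)
    simp only [good] at hJg
    omega
  by_cases hall : Finset.range N ⊆ J
  · refine ⟨∅, ⊥, by simp, ?_, ?_⟩
    · intro h hh
      exact ⟨0, by simp, by simpa using hh.symm⟩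
    · rw [← hJN.antisymm hall]
      omega
  obtain ⟨i₁, hi₁, hi₁J⟩ := Finset.not_subset.1 hall
  obtain ⟨k, hk, hkmin⟩ := Finset.exists_min_image (Finset.range N \ J) id
    ⟨i₁, Finset.mem_sdiff.2 ⟨hi₁, hi₁J⟩⟩
  obtain ⟨hkN, hkJ⟩ := Finset.mem_sdiff.1 hk
  rw [Finset.mem_range] at hkN
  set H := AddSubgroup.closure (Y k : Set G) with hH
  set S := ∑ i ∈ J, Y i with hS
  have h0S : (0 : G) ∈ S := by
    rw [hS, ← Finset.mem_coe, Finset.coe_sum, Set.mem_finsetSum]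
    exact ⟨0, fun {i} hi => h0 i (Finset.mem_range.1 (hJN hi)), by simp⟩
  have hnot : ¬ good (insert k J) := fun hg => by
    have := hmax (insert k J) (Finset.mem_filter.2 ⟨Finset.mem_powerset.2
      (Finset.insert_subset (Finset.mem_range.2 hkN) hJN), hg⟩)
    rw [Finset.card_insert_of_notMem hkJ] at this
    omega
  set Hf : Finset G := Finset.univ.filter (· ∈ H) with hHf
  -- If H were not covered, Olson's inequality applied inside H would make `insert k J` good,
  -- against maximality.
  have hcover : (S ∩ Hf) + Y k = Hf := by
    by_contra hne
    have h1 := card_add_two_mul_card_le (h0 k hkN) (H := Hf) (by ext; simp [hHf, hH])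
      Finset.inter_subset_right ⟨0, by simp [h0S, hHf]⟩ hne
    have h2 : (S ∩ Hf + Y k) \ (S ∩ Hf) ⊆ (S + Y k) \ S := by
      intro x hx
      obtain ⟨hx1, hx2⟩ := Finset.mem_sdiff.1 hx
      obtain ⟨a, ha, b, hb, rfl⟩ := Finset.mem_add.1 hx1
      obtain ⟨ha1, ha2⟩ := Finset.mem_inter.1 ha
      refine Finset.mem_sdiff.2 ⟨Finset.add_mem_add ha1 hb, fun hmem => hx2 ?_⟩
      refine Finset.mem_inter.2 ⟨hmem, ?_⟩
      simp only [hHf, Finset.mem_filter, Finset.mem_univ, true_and] at ha2 ⊢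
      exact add_mem ha2 (AddSubgroup.subset_closure hb)
    have h3 := Finset.card_le_card h2
    have h4 := Finset.card_sdiff_add_card_eq_card (Finset.subset_add_left (S ∩ Hf) (h0 k hkN))
    have h5 := Finset.card_sdiff_add_card_eq_card (Finset.subset_add_left S (h0 k hkN))
    apply hnot
    simp only [good] at hJg ⊢
    rw [Finset.sum_insert hkJ, Finset.sum_insert hkJ, add_comm (Y k) _, ← hS]
    rw [← hS] at hJg
    omega
  refine ⟨insert k J, H, Finset.insert_subset (Finset.mem_range.2 hkN) hJN, ?_, ?_⟩
  · intro h hh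
    have : h ∈ S ∩ Hf + Y k := by rw [hcover]; simp [hHf, hh]
    obtain ⟨a, ha, b, hb, rfl⟩ := Finset.mem_add.1 this
    apply key
    rw [Finset.sum_insert hkJ, add_comm a b]
    exact Finset.add_mem_add hb (Finset.mem_inter.1 ha).1
  · rw [← Finset.sum_sdiff hJN]
    -- Since k is the least unused index and the chain decreases, every unused member lies in the
    -- subgroup generated by `Y k`.
    have hbd : ∀ i ∈ Finset.range N \ J, (Y i).card ≤ Nat.card H := by
      intro i hi
      have hki : k ≤ i := hkmin i hi
      have hiN := Finset.mem_range.1 (Finset.mem_sdiff.1 hi).1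
      have hsubs : Y i ⊆ Hf := fun x hx => by
        simp only [hHf, Finset.mem_filter, Finset.mem_univ, true_and]
        exact AddSubgroup.subset_closure (hanti k i hki hiN hx)
      refine (Finset.card_le_card hsubs).trans (le_of_eq ?_)
      rw [Nat.card_eq_fintype_card, Fintype.card_subtype]
    have h1 := Finset.sum_le_card_nsmul _ _ _ hbd
    have h2 : (Finset.range N \ J).card ≤ N := by
      simpa using Finset.card_le_card (Finset.sdiff_subset (s := Finset.range N) (t := J))
    have h3 := Nat.mul_le_mul_right (Nat.card H) h2
    simp only [smul_eq_mul] at h1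
    omega

/-! ### Progressions of subset sums: refining, absorbing, lengthening -/

theorem subsetSums_mono {A B : Finset ℕ} (h : A ⊆ B) : subsetSums A ⊆ subsetSums B := by
  rintro s ⟨S, hS, rfl⟩
  exact ⟨S, hS.trans h, rfl⟩

theorem zero_mem_subsetSums (A : Finset ℕ) : 0 ∈ subsetSums A := ⟨∅, by simp, by simp⟩

theorem mem_subsetSums_of_mem {A : Finset ℕ} {a : ℕ} (h : a ∈ A) : a ∈ subsetSums A :=
  ⟨{a}, by simpa using h, by simp⟩

theorem add_mem_subsetSums {A B : Finset ℕ} (h : Disjoint A B) {s t : ℕ}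
    (hs : s ∈ subsetSums A) (ht : t ∈ subsetSums B) : s + t ∈ subsetSums (A ∪ B) := by
  obtain ⟨S, hS, rfl⟩ := hs
  obtain ⟨T, hT, rfl⟩ := ht
  exact ⟨S ∪ T, Finset.union_subset_union hS hT,
    Finset.sum_union (Finset.disjoint_of_subset_left hS (Finset.disjoint_of_subset_right hT h))⟩

theorem le_sum_of_mem_subsetSums {A : Finset ℕ} {s : ℕ} (hs : s ∈ subsetSums A) :
    s ≤ ∑ x ∈ A, x := by
  obtain ⟨S, hS, rfl⟩ := hs
  exact Finset.sum_le_sum_of_subset hS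

/-- The subset sums of `E` contain every member of the residue class of `c` modulo `d` in the
interval `[lo, lo + l]`. -/
def Fills (E : Finset ℕ) (d c lo l : ℕ) : Prop :=
  ∀ z, lo ≤ z → z ≤ lo + l → z ≡ c [MOD d] → z ∈ subsetSums E

theorem Fills.mono {E F : Finset ℕ} {d c lo l l' : ℕ} (h : Fills E d c lo l) (hEF : E ⊆ F)
    (hl : l' ≤ l) : Fills F d c lo l' := fun z h1 h2 h3 =>
  subsetSums_mono hEF (h z h1 (by omega) h3)

/-- Every subgroup of `ZMod q` consists of the multiples of a divisor of `q`. -/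
theorem exists_multiples_of_addSubgroup {q : ℕ} [NeZero q] (H : AddSubgroup (ZMod q)) :
    ∃ d : ℕ, 0 < d ∧ (∀ x : ℤ, (x : ZMod q) ∈ H ↔ (d : ℤ) ∣ x) ∧ d * Nat.card H = q := by
  set f : ℤ →+ ZMod q := Int.castAddHom (ZMod q) with hf
  obtain ⟨a, ha⟩ := Int.subgroup_cyclic (H.comap f)
  rw [← AddSubgroup.zmultiples_eq_closure] at ha
  have hmem : ∀ x : ℤ, (x : ZMod q) ∈ H ↔ ((a.natAbs : ℕ) : ℤ) ∣ x := fun x => by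
    rw [Int.natAbs_dvd, ← Int.mem_zmultiples_iff, ← ha]
    rfl
  have hidx : H.index = a.natAbs := by
    rw [← H.index_comap_of_surjective (f := f) (ZMod.intCast_surjective), ha,
      Int.index_zmultiples]
  have hcard : a.natAbs * Nat.card H = q := by
    rw [← hidx, mul_comm, AddSubgroup.card_mul_index, Nat.card_zmod]
  refine ⟨a.natAbs, Nat.pos_of_ne_zero fun h => NeZero.ne q ?_, hmem, hcard⟩
  rw [h] at hcard
  omega

/-- Adding to an arithmetic progression of difference `d` a set of subset sums that covers a coset
of `d' ℤ` modulo `d` gives an arithmetic progression of difference `d'`. -/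
theorem Fills.refine {E B : Finset ℕ} {d d' c lo l t₀ T : ℕ} [NeZero d] (hE : Fills E d c lo l)
    (hEB : Disjoint E B) {H : AddSubgroup (ZMod d)}
    (hH : ∀ x : ℤ, (x : ZMod d) ∈ H ↔ (d' : ℤ) ∣ x) {b : ZMod d}
    (hB : ∀ h ∈ H, ∃ t ∈ subsetSums B, t₀ ≤ t ∧ t ≤ t₀ + T ∧ (t : ZMod d) = b + h) (hT : T ≤ l) :
    ∃ c', Fills (E ∪ B) d' c' (lo + t₀ + T) (l - T) := by
  refine ⟨((c : ZMod d) + b).val, fun z h1 h2 h3 => ?_⟩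
  have hz : (((z : ℤ) - (((c : ZMod d) + b).val : ℤ) : ℤ) : ZMod d) ∈ H := by
    rw [hH]
    exact (Nat.modEq_iff_dvd.1 h3.symm)
  obtain ⟨t, htB, ht1, ht2, ht3⟩ := hB _ hz
  have ht3' : (t : ZMod d) = z - c := by
    rw [ht3]
    push_cast
    rw [ZMod.natCast_zmod_val]
    ring
  have hzt : z = (z - t) + t := by omega
  rw [hzt]
  refine add_mem_subsetSums hEB (hE _ (by omega) (by omega) ?_) htB
  rw [← ZMod.natCast_eq_natCast_iff, Nat.cast_sub (by omega), ht3']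
  ring

/-- A maximal sum of two-element sets, formed from disjoint parts of `R`, covers modulo `d` a coset
of a subgroup `H` which contains all the differences that the unused part of `R` still offers. -/
theorem exists_absorbing (d : ℕ) [NeZero d] (R : Finset ℕ) (v D : ℕ) :
    ∃ (U : Finset ℕ) (k : ℕ) (H : AddSubgroup (ZMod d)) (b : ZMod d), U ⊆ R ∧ k < d ∧
      U.card ≤ 2 * k ∧
      (∀ h ∈ H, ∃ t ∈ subsetSums U, k * v ≤ t ∧ t ≤ k * v + k * D ∧ (t : ZMod d) = b + h) ∧
      ∀ U₀ ⊆ R \ U, U₀.card ≤ 2 → ∀ s ∈ subsetSums U₀, ∀ t ∈ subsetSums U₀,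
        v ≤ s → s ≤ v + D → v ≤ t → t ≤ v + D → (t : ZMod d) - s ∈ H := by
  classical
  set P : ℕ → Prop := fun k => ∃ (U : Finset ℕ) (F : Finset (ZMod d)), U ⊆ R ∧ U.card ≤ 2 * k ∧
    k + 1 ≤ F.card ∧ ∀ f ∈ F, ∃ t ∈ subsetSums U, k * v ≤ t ∧ t ≤ k * v + k * D ∧ (t : ZMod d) = f
    with hP
  have hPd : ∀ k, P k → k < d := by
    rintro k ⟨U, F, -, -, hF, -⟩
    have := Finset.card_le_univ F
    rw [ZMod.card] at this
    omega
  have hP0 : P 0 := ⟨∅, {0}, by simp, by simp, by simp, by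
    intro f hf
    exact ⟨0, zero_mem_subsetSums _, by simp, by simp, by rw [Finset.mem_singleton.1 hf, Nat.cast_zero]⟩⟩
  obtain ⟨k, hk, hmax⟩ := Finset.exists_max_image ((Finset.range d).filter P) id
    ⟨0, Finset.mem_filter.2 ⟨Finset.mem_range.2 (hPd 0 hP0), hP0⟩⟩
  have hnot : ¬ P (k + 1) := fun h => by
    have := hmax (k + 1) (Finset.mem_filter.2 ⟨Finset.mem_range.2 (hPd _ h), h⟩)
    simp at this
  obtain ⟨U, F, hUR, hUc, hFc, hF⟩ := (Finset.mem_filter.1 hk).2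
  obtain ⟨b, hb⟩ : F.Nonempty := Finset.card_pos.1 (by omega)
  refine ⟨U, k, AddAction.stabilizer (ZMod d) F, b, hUR, hPd k (Finset.mem_filter.1 hk).2, hUc,
    fun h hh => ?_, fun U₀ hU₀ hc s hs t ht hs1 hs2 ht1 ht2 => ?_⟩
  · refine hF _ ?_
    rw [AddAction.mem_stabilizer_iff] at hh
    rw [← hh, add_comm, ← vadd_eq_add]
    exact Finset.vadd_mem_vadd_finset hb
  · by_contra hcon
    apply hnot
    have hdisj : Disjoint U U₀ := by
      rw [Finset.disjoint_left]
      exact fun a ha ha' => (Finset.mem_sdiff.1 (hU₀ ha')).2 ha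
    refine ⟨U ∪ U₀, ((s : ZMod d) +ᵥ F) ∪ ((t : ZMod d) +ᵥ F),
      Finset.union_subset hUR (hU₀.trans Finset.sdiff_subset), ?_, ?_, ?_⟩
    · have := Finset.card_union_le U U₀
      omega
    · have h1 : F.card < (((s : ZMod d) +ᵥ F) ∪ ((t : ZMod d) +ᵥ F)).card := by
        by_contra! hle
        have h2 : (s : ZMod d) +ᵥ F = ((s : ZMod d) +ᵥ F) ∪ ((t : ZMod d) +ᵥ F) :=
          Finset.eq_of_subset_of_card_le Finset.subset_union_left
            (by rwa [Finset.card_vadd_finset])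
        have h3 : (t : ZMod d) +ᵥ F = ((s : ZMod d) +ᵥ F) ∪ ((t : ZMod d) +ᵥ F) :=
          Finset.eq_of_subset_of_card_le Finset.subset_union_right
            (by rwa [Finset.card_vadd_finset])
        apply hcon
        rw [AddAction.mem_stabilizer_iff, sub_eq_neg_add, add_vadd, h3, ← h2, neg_vadd_vadd]
      omega
    · have hmove : ∀ w ∈ subsetSums U₀, v ≤ w → w ≤ v + D → ∀ f ∈ (w : ZMod d) +ᵥ F,
          ∃ t ∈ subsetSums (U ∪ U₀), (k + 1) * v ≤ t ∧ t ≤ (k + 1) * v + (k + 1) * D ∧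
            (t : ZMod d) = f := by
        intro w hw hw1 hw2 f hf
        obtain ⟨g, hg, rfl⟩ := Finset.mem_vadd_finset.1 hf
        obtain ⟨t, ht, ht1, ht2, rfl⟩ := hF g hg
        refine ⟨t + w, add_mem_subsetSums hdisj ht hw, ?_, ?_, ?_⟩
        · rw [add_mul]; omega
        · rw [add_mul, add_mul]; omega
        · rw [vadd_eq_add, Nat.cast_add, add_comm]
      intro f hf
      rcases Finset.mem_union.1 hf with hf | hf
      · exact hmove s hs hs1 hs2 f hf
      · exact hmove t ht ht1 ht2 f hf

/-- An arithmetic progression of subset sums grows when two further elements of a common residue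
class become available. -/
theorem Fills.insert_pair {E : Finset ℕ} {d c lo l r r' : ℕ} (hE : Fills E d c lo l)
    (hr : r ∉ E) (hr' : r' ∉ E) (hlt : r ≤ r') (hmod : r ≡ r' [MOD d]) (hl : r' - r ≤ l) :
    Fills (E ∪ {r, r'}) d (c + r) (lo + r) (l + (r' - r)) := by
  have hstep : ∀ w ∈ ({r, r'} : Finset ℕ), ∀ z, w ≤ z → z - w ∈ subsetSums E →
      z ∈ subsetSums (E ∪ {r, r'}) := by
    intro w hw z hwz hz
    have hwE : w ∉ E := by
      rcases Finset.mem_insert.1 hw with rfl | hw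
      · exact hr
      · rwa [Finset.mem_singleton.1 hw]
    have := add_mem_subsetSums (Finset.disjoint_singleton_right.2 hwE) hz
      (mem_subsetSums_of_mem (Finset.mem_singleton_self w))
    rw [Nat.sub_add_cancel hwz] at this
    exact subsetSums_mono
      (Finset.union_subset_union_right (Finset.singleton_subset_iff.2 hw)) this
  intro z h1 h2 h3
  by_cases hz : z ≤ lo + r + l
  · refine hstep r (by simp) z (by omega) (hE _ (by omega) (by omega) ?_)
    refine Nat.ModEq.add_right_cancel' r ?_
    rwa [Nat.sub_add_cancel (by omega)]
  · refine hstep r' (by simp) z (by omega) (hE _ (by omega) (by omega) ?_)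
    refine Nat.ModEq.add_right_cancel' r' ?_
    rw [Nat.sub_add_cancel (by omega)]
    exact h3.trans (hmod.add_left c)

/-- A multiple of d shifts the progression within its own residue class, and r ≤ l makes the two
copies overlap; the starting point does not move. -/
theorem Fills.insert_of_dvd {E : Finset ℕ} {d lo l r : ℕ} (hE : Fills E d 0 lo l)
    (hr : r ∉ E) (hd : d ∣ r) (hl : r ≤ l) : Fills (insert r E) d 0 lo (l + r) := by
  intro z h1 h2 h3
  by_cases hz : z ≤ lo + l
  · exact subsetSums_mono (Finset.subset_insert _ _) (hE z h1 hz h3)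
  · have hmem := hE (z - r) (by omega) (by omega) (by
      refine Nat.ModEq.add_right_cancel' r ?_
      rw [Nat.sub_add_cancel (by omega)]
      refine h3.trans ?_
      rw [zero_add]
      exact (Nat.modEq_zero_iff_dvd.2 hd).symm)
    have := add_mem_subsetSums (Finset.disjoint_singleton_right.2 hr) hmem
      (mem_subsetSums_of_mem (Finset.mem_singleton_self r))
    rw [Nat.sub_add_cancel (by omega)] at this
    exact subsetSums_mono (by rw [Finset.union_comm]; rfl) this

theorem Fills.union_of_dvd {E B : Finset ℕ} {d lo l : ℕ} (hE : Fills E d 0 lo l)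
    (hEB : Disjoint E B) (hB : ∀ b ∈ B, d ∣ b ∧ b ≤ l) :
    Fills (E ∪ B) d 0 lo (l + ∑ b ∈ B, b) := by
  induction B using Finset.induction_on with
  | empty => simpa using hE
  | insert b B hb ih =>
    rw [Finset.disjoint_insert_right] at hEB
    have h1 := ih hEB.2 fun x hx => hB x (Finset.mem_insert_of_mem hx)
    have h2 := hB b (Finset.mem_insert_self b B)
    have h3 := h1.insert_of_dvd (r := b) (by simp [hEB.1, hb]) h2.1 (by omega)
    rw [Finset.sum_insert hb, Finset.union_insert]
    refine h3.mono subset_rfl (by omega)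

/-- A set of integers in one residue class modulo `q` inside an interval of length `k q` has at
most `k + 1` elements. -/
theorem card_le_of_modEq {q k m : ℕ} (hq : 0 < q) (F : Finset ℕ)
    (hF : ∀ s ∈ F, m ≤ s ∧ s ≤ m + k * q) (hmod : ∀ s ∈ F, ∀ t ∈ F, s ≡ t [MOD q]) :
    F.card ≤ k + 1 := by
  rw [← Finset.card_range (k + 1)]
  refine Finset.card_le_card_of_injOn (fun s => (s - m) / q) ?_ ?_
  · intro s hs
    have := hF s hs
    simp only [Finset.coe_range, Set.mem_Iio]
    rw [Nat.div_lt_iff_lt_mul hq, add_mul]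
    omega
  · intro s hs t ht hst
    have h1 := hF s hs
    have h2 := hF t ht
    have h3 : s - m ≡ t - m [MOD q] := by
      refine Nat.ModEq.add_right_cancel' m ?_
      rw [Nat.sub_add_cancel h1.1, Nat.sub_add_cancel h2.1]
      exact hmod s hs t ht
    have h4 := Nat.div_add_mod (s - m) q
    have h5 := Nat.div_add_mod (t - m) q
    simp only at hst
    rw [hst, show (s - m) % q = (t - m) % q from h3] at h4
    omega

/-- Elements of one residue class modulo `d` in a window shorter than the progression extend the
progression by a quadratic number of steps. -/
theorem Fills.exists_extend {d x D : ℕ} (hd : 0 < d) (k : ℕ) :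
    ∀ (E R : Finset ℕ) (c lo l : ℕ), Fills E d c lo l → Disjoint E R → 2 * k ≤ R.card →
      (∀ r ∈ R, x ≤ r ∧ r ≤ x + D) → (∀ r ∈ R, ∀ r' ∈ R, r ≡ r' [MOD d]) → D ≤ l →
      ∃ c' lo', Fills (E ∪ R) d c' lo' (l + d * k ^ 2) := by
  induction k with
  | zero =>
    intro E R c lo l hE _ _ _ _ _
    exact ⟨c, lo, hE.mono Finset.subset_union_left (by simp)⟩
  | succ k ih =>
    intro E R c lo l hE hER hk hR hmod hD
    have hne : R.Nonempty := Finset.card_pos.1 (by omega)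
    set r := R.min' hne with hr
    set r' := R.max' hne with hr'
    have hrR : r ∈ R := R.min'_mem hne
    have hrR' : r' ∈ R := R.max'_mem hne
    have hle : r ≤ r' := R.min'_le _ hrR'
    -- At least 2k + 2 elements of one class span at least 2k + 1 steps of d. Taking extreme pairs
    -- repeatedly adds up odd numbers, whence the square.
    have hgap : d * (2 * k + 1) ≤ r' - r := by
      have h1 := hmod r hrR r' hrR'
      obtain ⟨e, he⟩ := (Nat.modEq_iff_dvd' hle).1 h1
      have h2 := card_le_of_modEq hd R (m := r) (k := e) (fun s hs =>
        ⟨R.min'_le _ hs, by have := R.le_max' s hs; rw [mul_comm]; omega⟩) hmod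
      rw [he]
      exact Nat.mul_le_mul_left d (by omega)
    have hdis := Finset.disjoint_right.1 hER
    have hr1 := hR r hrR
    have hr2 := hR r' hrR'
    have h1 := hE.insert_pair (hdis hrR) (hdis hrR') hle (hmod r hrR r' hrR') (by omega)
    have hsub : ({r, r'} : Finset ℕ) ⊆ R :=
      Finset.insert_subset hrR (Finset.singleton_subset_iff.2 hrR')
    have h2 := Finset.card_sdiff_add_card_eq_card hsub
    have h3 : ({r, r'} : Finset ℕ).card ≤ 2 := Finset.card_le_two
    obtain ⟨c', lo', hfin⟩ := ih (E ∪ {r, r'}) (R \ {r, r'}) _ _ _ h1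
      (Finset.disjoint_union_left.2
        ⟨Finset.disjoint_of_subset_right Finset.sdiff_subset hER, Finset.disjoint_sdiff⟩)
      (by omega) (fun s hs => hR s (Finset.mem_sdiff.1 hs).1)
      (fun s hs t ht => hmod s (Finset.mem_sdiff.1 hs).1 t (Finset.mem_sdiff.1 ht).1) (by omega)
    refine ⟨c', lo', hfin.mono ?_ ?_⟩
    · rw [Finset.union_assoc, Finset.union_sdiff_of_subset hsub]
    · have : d * (k + 1) ^ 2 = d * (2 * k + 1) + d * k ^ 2 := by ring
      omega

/-! ### Popular sums and differences -/

/-- The number of representations `s = a + b` with `a ∈ A` and `b ∈ B`. -/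
def sumCount (A B : Finset ℕ) (s : ℕ) : ℕ := ((A ×ˢ B).filter fun p => p.1 + p.2 = s).card

/-- The number of representations `t = b - a` with `a ∈ A` and `b ∈ B`. -/
def diffCount (A B : Finset ℕ) (t : ℕ) : ℕ := ((A ×ˢ B).filter fun p => p.2 = p.1 + t).card

/-- Sums that are sufficiently popular can be chosen freely and still be realised by disjoint
pairs. -/
theorem exists_subset_sum_eq {A B : Finset ℕ} (hAB : Disjoint A B) (x : ℕ → ℕ) (N : ℕ) :
    ∀ J ⊆ Finset.range N, (∀ i ∈ J, 2 * i < sumCount A B (x i)) →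
      ∃ U ⊆ A ∪ B, U.card ≤ 2 * N ∧ ∑ u ∈ U, u = ∑ i ∈ J, x i := by
  induction N with
  | zero =>
    intro J hJ _
    exact ⟨∅, by simp, by simp, by simp [Finset.subset_empty.1 hJ]⟩
  | succ N ih =>
    intro J hJ hx
    have hJ' : J.erase N ⊆ Finset.range N := fun i hi => by
      have h1 := Finset.mem_range.1 (hJ (Finset.mem_of_mem_erase hi))
      have h2 := Finset.ne_of_mem_erase hi
      rw [Finset.mem_range]; omega
    obtain ⟨U, hU, hUc, hUs⟩ := ih _ hJ' fun i hi => hx i (Finset.mem_of_mem_erase hi)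
    by_cases hN : N ∈ J
    swap
    · rw [Finset.erase_eq_of_notMem hN] at hUs
      exact ⟨U, hU, by omega, hUs⟩
    have hxN := hx N hN
    set P := (A ×ˢ B).filter fun p => p.1 + p.2 = x N with hP
    have hPmem : ∀ p ∈ P, p.1 ∈ A ∧ p.2 ∈ B ∧ p.1 + p.2 = x N := fun p hp => by
      simpa [hP, and_assoc] using hp
    -- Each used element spoils at most one representation of `x N`; at most 2N are used, while more
    -- than 2N representations exist.
    have hbad : (P.filter fun p => p.1 ∈ U ∨ p.2 ∈ U).card ≤ U.card := by
      refine Finset.card_le_card_of_injOn (fun p => if p.1 ∈ U then p.1 else p.2) ?_ ?_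
      · intro p hp
        have := (Finset.mem_filter.1 hp).2
        simp only
        split_ifs with h
        · exact h
        · exact this.resolve_left h
      · intro p hp p' hp' heq
        have h1 := hPmem p (Finset.mem_filter.1 hp).1
        have h2 := hPmem p' (Finset.mem_filter.1 hp').1
        have hd := Finset.disjoint_left.1 hAB
        simp only at heq
        split_ifs at heq with h3 h4 h4
        · exact Prod.ext heq (by omega)
        · exact absurd h2.2.1 (heq ▸ hd h1.1)
        · exact absurd h1.2.1 (heq ▸ hd h2.1)
        · exact Prod.ext (by omega) heq
    obtain ⟨p, hp, hpU⟩ : ∃ p ∈ P, ¬ (p.1 ∈ U ∨ p.2 ∈ U) := by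
      by_contra! hcon
      rw [Finset.filter_true_of_mem hcon] at hbad
      have : sumCount A B (x N) = P.card := rfl
      omega
    push Not at hpU
    obtain ⟨h1, h2, h3⟩ := hPmem p hp
    have hne : p.1 ≠ p.2 := fun h => Finset.disjoint_left.1 hAB h1 (h ▸ h2)
    refine ⟨insert p.1 (insert p.2 U), ?_, ?_, ?_⟩
    · exact Finset.insert_subset (Finset.mem_union_left _ h1)
        (Finset.insert_subset (Finset.mem_union_right _ h2) hU)
    · have h4 := Finset.card_insert_le p.1 (insert p.2 U)
      have h5 := Finset.card_insert_le p.2 U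
      omega
    · rw [Finset.sum_insert (by simp [hne, hpU.1]), Finset.sum_insert hpU.2, hUs,
        ← Finset.add_sum_erase J x hN, ← h3, add_assoc]

/-- The additive energy bound: the sums are as spread out as the differences. -/
theorem sum_sumCount_sq_le {A B : Finset ℕ} (hlt : ∀ a ∈ A, ∀ b ∈ B, a < b) {M : ℕ}
    (hM : ∀ t, diffCount A B t ≤ M) (S : Finset ℕ) (hS : ∀ a ∈ A, ∀ b ∈ B, a + b ∈ S) :
    ∑ s ∈ S, sumCount A B s ^ 2 ≤ M * (A.card * B.card) := by
  have h1 : ∑ s ∈ S, sumCount A B s ^ 2 = ∑ p ∈ A ×ˢ B, sumCount A B (p.1 + p.2) := by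
    rw [← Finset.sum_fiberwise_of_maps_to (t := S) (g := fun p : ℕ × ℕ => p.1 + p.2)
      (f := fun p => sumCount A B (p.1 + p.2)) (fun p hp => hS _ (Finset.mem_product.1 hp).1 _ (Finset.mem_product.1 hp).2)]
    refine Finset.sum_congr rfl fun s _ => ?_
    have : ∀ p ∈ (A ×ˢ B).filter fun p => p.1 + p.2 = s,
        sumCount A B (p.1 + p.2) = sumCount A B s := fun p hp => by
      rw [(Finset.mem_filter.1 hp).2]
    rw [sq, ← smul_eq_mul]
    exact (Finset.sum_const _).symm.trans (Finset.sum_congr rfl this).symm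
  have h2 : ∑ p ∈ A ×ˢ B, sumCount A B (p.1 + p.2) =
      (((A ×ˢ B) ×ˢ (A ×ˢ B)).filter fun P => P.2.1 + P.2.2 = P.1.1 + P.1.2).card := by
    rw [Finset.card_filter, Finset.sum_product (A ×ˢ B) (A ×ˢ B)]
    refine Finset.sum_congr rfl fun p _ => ?_
    rw [sumCount, Finset.card_filter]
  rw [h1, h2, ← Finset.card_product]
  -- Rewrite a' + b' = a + b as b - a' = b' - a: once a' and b are fixed, the pair (a, b') has a
  -- prescribed difference, leaving at most M choices.
  refine Finset.card_le_mul_card_image_of_maps_to (f := fun P => (P.2.1, P.1.2)) ?_ M ?_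
  · intro P hP
    simp only [Finset.mem_filter, Finset.mem_product] at hP ⊢
    exact ⟨hP.1.2.1, hP.1.1.2⟩
  · rintro ⟨a, b⟩ hab
    obtain ⟨ha, hb⟩ := Finset.mem_product.1 hab
    have hab' := hlt a ha b hb
    refine (Finset.card_le_card_of_injOn (fun P => (P.1.1, P.2.2)) ?_ ?_).trans (hM (b - a))
    · intro P hP
      simp only [Finset.coe_filter, Finset.mem_filter, Finset.mem_product, Set.mem_ofPred_eq,
        Prod.mk.injEq] at hP ⊢
      exact ⟨⟨hP.1.1.1.1, hP.1.1.2.2⟩, by omega⟩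
    · rintro ⟨⟨a1, a2⟩, ⟨b1, b2⟩⟩ hP ⟨⟨c1, c2⟩, ⟨d1, d2⟩⟩ hQ heq
      simp only [Finset.coe_filter, Finset.mem_filter, Finset.mem_product, Set.mem_ofPred_eq,
        Prod.mk.injEq] at hP hQ heq ⊢
      omega

/-- The layers `{s : sumCount A B s > 2 i}` with `i < N` have large total size. -/
theorem mul_card_mul_card_le_sum_layers {A B : Finset ℕ} (hlt : ∀ a ∈ A, ∀ b ∈ B, a < b)
    {M N : ℕ} (hM0 : 0 < M) (hNM : N ≤ M) (hM : ∀ t, diffCount A B t ≤ M)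
    (S : Finset ℕ) (hS : ∀ a ∈ A, ∀ b ∈ B, a + b ∈ S) :
    N * (A.card * B.card) ≤
      4 * M * ∑ i ∈ Finset.range N, (S.filter fun s => 2 * i < sumCount A B s).card := by
  set c : ℕ → ℕ := fun s => ((Finset.range N).filter fun i => 2 * i < sumCount A B s).card with hc
  have hswap : ∑ i ∈ Finset.range N, (S.filter fun s => 2 * i < sumCount A B s).card =
      ∑ s ∈ S, c s :=
    Finset.sum_card_bipartiteAbove_eq_sum_card_bipartiteBelow _
  have hcs : ∀ s, N ≤ c s ∨ sumCount A B s ≤ 2 * c s := by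
    intro s
    by_contra! hcon
    have : Finset.range (c s + 1) ⊆ (Finset.range N).filter fun i => 2 * i < sumCount A B s := by
      intro i hi
      simp only [Finset.mem_filter, Finset.mem_range] at hi ⊢
      omega
    have := Finset.card_le_card this
    rw [Finset.card_range] at this
    simp only [hc] at this
    omega
  -- Summed over s, the quadratic term is at most half of the left side by the energy bound, and the
  -- rest must come from the layers.
  have hpt : ∀ s, N * (2 * M * sumCount A B s) ≤ 4 * M ^ 2 * c s + N * sumCount A B s ^ 2 := by
    intro s
    set r := sumCount A B s
    rcases hcs s with h | h
    · have h1 : 2 * M * r ≤ M ^ 2 + r ^ 2 := by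
        zify; nlinarith [sq_nonneg ((M : ℤ) - r)]
      calc N * (2 * M * r) ≤ N * (M ^ 2 + r ^ 2) := Nat.mul_le_mul_left _ h1
        _ = N * M ^ 2 + N * r ^ 2 := by ring
        _ ≤ c s * M ^ 2 + N * r ^ 2 := by gcongr
        _ ≤ 4 * M ^ 2 * c s + N * r ^ 2 := by nlinarith [Nat.zero_le (c s * M ^ 2)]
    · calc N * (2 * M * r) ≤ M * (2 * M * (2 * c s)) := by gcongr
        _ = 4 * M ^ 2 * c s := by ring
        _ ≤ _ := Nat.le_add_right _ _
  have htot : ∑ s ∈ S, sumCount A B s = A.card * B.card := by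
    rw [← Finset.card_product]
    exact (Finset.card_eq_sum_card_fiberwise fun p hp =>
      hS _ (Finset.mem_product.1 hp).1 _ (Finset.mem_product.1 hp).2).symm
  have hE := sum_sumCount_sq_le hlt hM S hS
  have hsum := Finset.sum_le_sum fun s (_ : s ∈ S) => hpt s
  rw [Finset.sum_add_distrib, ← Finset.mul_sum, ← Finset.mul_sum, ← Finset.mul_sum,
    ← Finset.mul_sum, htot, ← hswap] at hsum
  set W := ∑ i ∈ Finset.range N, (S.filter fun s => 2 * i < sumCount A B s).card
  have h3 : N * ∑ s ∈ S, sumCount A B s ^ 2 ≤ N * (M * (A.card * B.card)) :=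
    Nat.mul_le_mul_left _ hE
  refine Nat.le_of_mul_le_mul_left ?_ hM0
  nlinarith

/-! ### Finding two separated dense groups -/

/-- The `p` smallest elements of a finite set. -/
theorem exists_subset_card_lt {A : Finset ℕ} (p : ℕ) : p ≤ A.card →
    ∃ L ⊆ A, L.card = p ∧ ∀ a ∈ L, ∀ b ∈ A \ L, a < b := by
  induction p with
  | zero => exact fun _ => ⟨∅, by simp⟩
  | succ p ih =>
    intro hp
    obtain ⟨L, hL, hLc, hlt⟩ := ih (by omega)
    have hne : (A \ L).Nonempty := by
      rw [← Finset.card_pos]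
      have := Finset.card_sdiff_add_card_eq_card hL
      omega
    have hm := (A \ L).min'_mem hne
    obtain ⟨hm1, hm2⟩ := Finset.mem_sdiff.1 hm
    refine ⟨insert ((A \ L).min' hne) L, Finset.insert_subset hm1 hL,
      by rw [Finset.card_insert_of_notMem hm2, hLc], ?_⟩
    intro a ha b hb
    rw [Finset.mem_sdiff, Finset.mem_insert, not_or] at hb
    have hbL : b ∈ A \ L := Finset.mem_sdiff.2 ⟨hb.1, hb.2.2⟩
    rcases Finset.mem_insert.1 ha with rfl | ha
    · exact lt_of_le_of_ne (Finset.min'_le _ _ hbL) (Ne.symm hb.2.1)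
    · exact hlt a ha b hbL

/-- The `p` largest elements of a finite set. -/
theorem exists_subset_card_gt {A : Finset ℕ} (p : ℕ) (hp : p ≤ A.card) :
    ∃ L ⊆ A, L.card = p ∧ ∀ a ∈ L, ∀ b ∈ A \ L, b < a := by
  obtain ⟨L, hL, hLc, hlt⟩ := exists_subset_card_lt (A := A) (A.card - p) (by omega)
  have := Finset.card_sdiff_add_card_eq_card hL
  refine ⟨A \ L, Finset.sdiff_subset, by omega, fun a ha b hb => hlt b ?_ a ha⟩
  rwa [Finset.sdiff_sdiff_eq_self hL] at hb

/-- A dense set has a window with two separated dense parts, and with many further elements. -/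
theorem exists_separated (K r : ℕ) (hK : 9 ≤ K) (hr : 2 ≤ r) (p : ℕ) : ∀ (A : Finset ℕ) (x D : ℕ),
    (∀ a ∈ A, x ≤ a ∧ a ≤ x + D) → K * D ≤ p ^ 2 → r + 6 * p ≤ A.card →
    ∃ (A₁ A₂ R : Finset ℕ) (x' D' p' : ℕ), A₁ ⊆ A ∧ A₂ ⊆ A ∧ R ⊆ A ∧
      Disjoint A₁ R ∧ Disjoint A₂ R ∧ (∀ a ∈ A₁, ∀ b ∈ A₂, a < b) ∧
      (∀ a ∈ A₁ ∪ A₂ ∪ R, x' ≤ a ∧ a ≤ x' + D') ∧ A₁.card = p' ∧ A₂.card = p' ∧ p' ≤ p ∧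
      r ≤ R.card ∧ 1 ≤ D' ∧ K * D' ≤ p' ^ 2 ∧ ∀ a ∈ A₁, ∀ b ∈ A₂, D' + 10 * a ≤ 10 * b := by
  induction p using Nat.strong_induction_on with
  | _ p ih =>
  intro A x D hA hKD hc
  have hD : 1 ≤ D := by
    by_contra! hD
    have : A ⊆ {x} := fun a ha => by
      have := hA a ha
      rw [Finset.mem_singleton]; omega
    have := Finset.card_le_card this
    rw [Finset.card_singleton] at this
    omega
  have hp : 3 ≤ p := by
    by_contra! hp
    have : p ^ 2 ≤ 2 ^ 2 := Nat.pow_le_pow_left (by omega) 2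
    nlinarith
  obtain ⟨A₁, hA₁, hc₁, hlt₁⟩ := exists_subset_card_lt (A := A) p (by omega)
  have hs₁ := Finset.card_sdiff_add_card_eq_card hA₁
  obtain ⟨A₂, hA₂, hc₂, hlt₂⟩ := exists_subset_card_gt (A := A \ A₁) p (by omega)
  have hs₂ := Finset.card_sdiff_add_card_eq_card hA₂
  set R := (A \ A₁) \ A₂ with hR
  have hRA : R ⊆ A := Finset.sdiff_subset.trans Finset.sdiff_subset
  have h12 : ∀ a ∈ A₁, ∀ b ∈ A₂, a < b := fun a ha b hb => hlt₁ a ha b (hA₂ hb)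
  have h1R : Disjoint A₁ R :=
    Finset.disjoint_of_subset_right Finset.sdiff_subset Finset.disjoint_sdiff
  have h2R : Disjoint A₂ R := Finset.disjoint_sdiff
  by_cases hsep : ∀ a ∈ A₁, ∀ b ∈ A₂, D + 10 * a ≤ 10 * b
  · exact ⟨A₁, A₂, R, x, D, p, hA₁, hA₂.trans Finset.sdiff_subset, hRA, h1R, h2R, h12,
      fun a ha => hA a (Finset.union_subset (Finset.union_subset hA₁
        (hA₂.trans Finset.sdiff_subset)) hRA ha), hc₁, hc₂, le_rfl, by omega, hD, hKD, hsep⟩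
  push Not at hsep
  obtain ⟨a, ha, b, hb, hab⟩ := hsep
  -- Without separation the middle part lies in a window shorter than D / 10. Halving p costs only a
  -- factor of about 4 in p², so density survives, and the discarded 2p per round stay within 6p in
  -- total.
  have hRab : ∀ y ∈ R, a ≤ y ∧ y ≤ a + (b - a) := fun y hy => by
    have h1 := hlt₁ a ha y (Finset.sdiff_subset hy)
    have h2 := hlt₂ b hb y hy
    omega
  have hq : p ^ 2 ≤ (2 * ((p + 1) / 2)) ^ 2 := Nat.pow_le_pow_left (by omega) 2
  obtain ⟨B₁, B₂, R', x', D', p', hB₁, hB₂, hR', h1, h2, h3, h4, h5, h6, h7, h8⟩ :=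
    ih ((p + 1) / 2) (by omega) R a (b - a) hRab
    (by
      have : K * (10 * (b - a)) ≤ K * D := Nat.mul_le_mul_left _ (by omega)
      nlinarith) (by omega)
  exact ⟨B₁, B₂, R', x', D', p', hB₁.trans hRA, hB₂.trans hRA, hR'.trans hRA, h1, h2, h3, h4, h5,
    h6, by omega, h8⟩

/-! ### From a popular difference to a progression of small difference -/

/-- Disjoint pairs of common difference `q` yield an arithmetic progression of difference `q`. -/
theorem add_mul_mem_subsetSums_of_pairs {q : ℕ} (Q : Finset (ℕ × ℕ))
    (hQ : ∀ p ∈ Q, p.2 = p.1 + q) (hlt : ∀ p ∈ Q, ∀ p' ∈ Q, p.1 < p'.2) :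
    ∀ j ≤ Q.card, ∑ p ∈ Q, p.1 + j * q ∈ subsetSums (Q.image Prod.fst ∪ Q.image Prod.snd) := by
  induction Q using Finset.induction_on with
  | empty =>
    intro j hj
    rw [Finset.card_empty, Nat.le_zero] at hj
    subst hj
    simpa using zero_mem_subsetSums ∅
  | insert p Q hp ih =>
    have hQ' : ∀ p' ∈ Q, p'.2 = p'.1 + q := fun p' hp' => hQ p' (Finset.mem_insert_of_mem hp')
    have ih' := ih hQ' fun a ha b hb =>
      hlt a (Finset.mem_insert_of_mem ha) b (Finset.mem_insert_of_mem hb)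
    have hpq := hQ p (Finset.mem_insert_self p Q)
    have hpp := hlt p (Finset.mem_insert_self p Q) p (Finset.mem_insert_self p Q)
    have hne : ∀ p' ∈ Q, p'.1 ≠ p.1 := fun p' hp' h => hp (by
      have : p = p' := Prod.ext h.symm (by rw [hpq, hQ' p' hp', h])
      rwa [this])
    have h1 : p.1 ∉ Q.image Prod.fst ∪ Q.image Prod.snd := by
      simp only [Finset.mem_union, Finset.mem_image, not_or, not_exists, not_and]
      refine ⟨fun p' hp' => hne p' hp', fun p' hp' h => ?_⟩
      have := hlt p (Finset.mem_insert_self p Q) p' (Finset.mem_insert_of_mem hp')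
      omega
    have h2 : p.2 ∉ Q.image Prod.fst ∪ Q.image Prod.snd := by
      simp only [Finset.mem_union, Finset.mem_image, not_or, not_exists, not_and]
      refine ⟨fun p' hp' h => ?_, fun p' hp' h => hne p' hp' (by have := hQ' p' hp'; omega)⟩
      have := hlt p' (Finset.mem_insert_of_mem hp') p (Finset.mem_insert_self p Q)
      omega
    intro j hj
    rw [Finset.card_insert_of_notMem hp] at hj
    rw [Finset.sum_insert hp]
    rcases Nat.eq_zero_or_pos j with rfl | hj0
    · have := add_mem_subsetSums (Finset.disjoint_singleton_right.2 h1) (ih' 0 (by omega))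
        (mem_subsetSums_of_mem (Finset.mem_singleton_self p.1))
      rw [show p.1 + ∑ p ∈ Q, p.1 + 0 * q = ∑ p ∈ Q, p.1 + 0 * q + p.1 by ring]
      refine subsetSums_mono ?_ this
      intro y; simp; tauto
    · obtain ⟨j, rfl⟩ : ∃ i, j = i + 1 := ⟨j - 1, by omega⟩
      have := add_mem_subsetSums (Finset.disjoint_singleton_right.2 h2) (ih' j (by omega))
        (mem_subsetSums_of_mem (Finset.mem_singleton_self p.2))
      rw [show p.1 + ∑ p ∈ Q, p.1 + (j + 1) * q = ∑ p ∈ Q, p.1 + j * q + (p.1 + q) by ring, ← hpq]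
      refine subsetSums_mono ?_ this
      intro y; simp; tauto

/-- Switching j pairs from first to second member raises the sum by jq; `hlt` ensures that no
element is a first member of one pair and a second member of another. -/
theorem fills_of_pairs {q : ℕ} (hq : 0 < q) (Q : Finset (ℕ × ℕ))
    (hQ : ∀ p ∈ Q, p.2 = p.1 + q) (hlt : ∀ p ∈ Q, ∀ p' ∈ Q, p.1 < p'.2) :
    Fills (Q.image Prod.fst ∪ Q.image Prod.snd) q (∑ p ∈ Q, p.1) (∑ p ∈ Q, p.1) (Q.card * q) := by
  intro z h1 h2 h3
  obtain ⟨j, hj⟩ := (Nat.modEq_iff_dvd' h1).1 h3.symm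
  have hz : z = ∑ p ∈ Q, p.1 + j * q := by rw [mul_comm]; omega
  rw [hz]
  refine add_mul_mem_subsetSums_of_pairs Q hQ hlt j (Nat.le_of_mul_le_mul_right (c := q) ?_ hq)
  omega

/-- Free choices from the layers of popular sums cover a large subgroup modulo `q`. -/
theorem exists_cover_of_layers {A B : Finset ℕ} (hlt : ∀ a ∈ A, ∀ b ∈ B, a < b) {x D q N : ℕ}
    [NeZero q] (hA : ∀ a ∈ A, x ≤ a ∧ a ≤ x + D) (hB : ∀ a ∈ B, x ≤ a ∧ a ≤ x + D)
    (hDq : D ≤ 10 * q) :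
    ∃ (H : AddSubgroup (ZMod q)) (b : ZMod q) (t₀ : ℕ),
      (∀ h ∈ H, ∃ t ∈ subsetSums (A ∪ B),
        t₀ ≤ t ∧ t ≤ t₀ + 2 * N * D ∧ (t : ZMod q) = b + h) ∧
      ∑ i ∈ Finset.range N, ((Finset.range (2 * (x + D) + 1)).filter
        fun s => 2 * i < sumCount A B s).card ≤ 21 * (2 * q + N * Nat.card H) := by
  classical
  have hAB : Disjoint A B := Finset.disjoint_left.2 fun a ha hb => lt_irrefl _ (hlt a ha a hb)
  set X : ℕ → Finset ℕ := fun i => (Finset.range (2 * (x + D) + 1)).filter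
    fun s => 2 * i < sumCount A B s with hX
  have hXmem : ∀ i, ∀ s ∈ X i, 2 * x ≤ s ∧ s ≤ 2 * x + 2 * D := by
    intro i s hs
    have hs' := (Finset.mem_filter.1 hs).2
    obtain ⟨p, hp⟩ : ((A ×ˢ B).filter fun p => p.1 + p.2 = s).Nonempty :=
      Finset.card_pos.1 (lt_of_le_of_lt (Nat.zero_le _) hs')
    obtain ⟨hp1, hp2⟩ := Finset.mem_filter.1 hp
    have h1 := hA _ (Finset.mem_product.1 hp1).1
    have h2 := hB _ (Finset.mem_product.1 hp1).2
    omega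
  have hXanti : ∀ i j, i ≤ j → X j ⊆ X i := fun i j hij s hs => by
    simp only [hX, Finset.mem_filter] at hs ⊢
    exact ⟨hs.1, by omega⟩
  -- Empty layers contribute nothing; the remaining ones have a common element u, and translating by
  -- it puts 0 into each.
  have hex : ∃ N' ≤ N, (∀ i < N', (X i).Nonempty) ∧ ∀ i, N' ≤ i → i < N → X i = ∅ := by
    have h : ∃ i, i = N ∨ X i = ∅ := ⟨N, Or.inl rfl⟩
    refine ⟨Nat.find h, Nat.find_min' h (Or.inl rfl), fun i hi => ?_, fun i hi hiN => ?_⟩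
    · have := Nat.find_min h hi
      rw [not_or] at this
      exact Finset.nonempty_iff_ne_empty.2 this.2
    · rcases Nat.find_spec h with h' | h'
      · omega
      · exact Finset.subset_empty.1 (h' ▸ hXanti _ _ hi)
  obtain ⟨N', hN', hne, hemp⟩ := hex
  have hW : ∑ i ∈ Finset.range N, (X i).card = ∑ i ∈ Finset.range N', (X i).card := by
    refine (Finset.sum_subset (Finset.range_subset_range.2 hN') fun i hi hi' => ?_).symm
    rw [hemp i (by simpa using hi') (Finset.mem_range.1 hi), Finset.card_empty]
  obtain ⟨u, hu⟩ : ∃ u, ∀ i < N', u ∈ X i := by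
    rcases Nat.eq_zero_or_pos N' with h | h
    · exact ⟨0, fun i hi => by omega⟩
    · obtain ⟨u, hu⟩ := hne (N' - 1) (by omega)
      exact ⟨u, fun i hi => hXanti i _ (by omega) hu⟩
  set Y : ℕ → Finset (ZMod q) := fun i => (X i).image fun s : ℕ => (s : ZMod q) - u with hY
  obtain ⟨J, H, hJ, hH, hcard⟩ := exists_subgroup_subset_sum N' Y
    (fun i hi => Finset.mem_image.2 ⟨u, hu i hi, sub_self _⟩)
    (fun i j hij _ => Finset.image_subset_image (hXanti i j hij))
  -- The sums lie in an interval of length 2D ≤ 20q, which meets each class modulo q at most 21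
  -- times.
  have hXY : ∀ i, (X i).card ≤ 21 * (Y i).card := by
    intro i
    refine Finset.card_le_mul_card_image _ 21 fun y _ => ?_
    refine card_le_of_modEq (q := q) (m := 2 * x) (k := 20) (NeZero.pos q) _ (fun s hs => ?_)
      fun s hs t ht => ?_
    · have := hXmem i s (Finset.mem_filter.1 hs).1
      omega
    · have h1 := (Finset.mem_filter.1 hs).2
      have h2 := (Finset.mem_filter.1 ht).2
      rw [← ZMod.natCast_eq_natCast_iff]
      exact sub_left_injective (h1.trans h2.symm)
  refine ⟨H, J.card * u, J.card * (2 * x), fun h hh => ?_, ?_⟩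
  · obtain ⟨y, hy, hys⟩ := hH h hh
    choose! f hf using fun i (hi : i ∈ J) => Finset.mem_image.1 (hy i hi)
    have hJN : J ⊆ Finset.range N' := hJ
    obtain ⟨U, hU, -, hUs⟩ := exists_subset_sum_eq hAB f N' J hJN fun i hi =>
      (Finset.mem_filter.1 (hf i hi).1).2
    refine ⟨∑ i ∈ J, f i, ⟨U, hU, hUs⟩, ?_, ?_, ?_⟩
    · have := Finset.card_nsmul_le_sum J f (2 * x) fun i hi => (hXmem i _ (hf i hi).1).1
      simpa using this
    · have h1 := Finset.sum_le_card_nsmul J f (2 * x + 2 * D)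
        fun i hi => (hXmem i _ (hf i hi).1).2
      have h2 : J.card ≤ N := by
        have := Finset.card_le_card hJN
        rw [Finset.card_range] at this
        omega
      have h3 := Nat.mul_le_mul_right (2 * D) h2
      rw [smul_eq_mul, mul_add] at h1
      have h4 : 2 * N * D = N * (2 * D) := by ring
      rw [h4]
      exact h1.trans (Nat.add_le_add_left h3 _)
    · rw [← hys, Nat.cast_sum, ← nsmul_eq_mul, ← Finset.sum_const, ← Finset.sum_add_distrib]
      refine Finset.sum_congr rfl fun i hi => ?_
      rw [← (hf i hi).2]
      ring
  · rw [hW]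
    calc ∑ i ∈ Finset.range N', (X i).card ≤ ∑ i ∈ Finset.range N', 21 * (Y i).card :=
          Finset.sum_le_sum fun i _ => hXY i
      _ = 21 * ∑ i ∈ Finset.range N', (Y i).card := by rw [Finset.mul_sum]
      _ ≤ 21 * (2 * q + N * Nat.card H) := by
          rw [ZMod.card] at hcard
          have := Nat.mul_le_mul_right (Nat.card H) hN'
          omega

/-- Two separated dense sets have an arithmetic progression among their subset sums which is long
compared with its difference. -/
theorem exists_fills_of_separated {A B : Finset ℕ} {x D p : ℕ}
    (hA : ∀ a ∈ A, x ≤ a ∧ a ≤ x + D) (hB : ∀ a ∈ B, x ≤ a ∧ a ≤ x + D)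
    (hcA : A.card = p) (hcB : B.card = p) (hlt : ∀ a ∈ A, ∀ b ∈ B, a < b) (hD : 1 ≤ D)
    (hp : 268800 * D ≤ p ^ 2) (hsep : ∀ a ∈ A, ∀ b ∈ B, D + 10 * a ≤ 10 * b) :
    ∃ N d c lo l : ℕ, 100 * N ≤ p ∧ 1 ≤ d ∧ d ≤ N ∧ 3 * N * D ≤ l ∧ Fills (A ∪ B) d c lo l := by
  classical
  obtain ⟨q, hqmem, hqmax⟩ := Finset.exists_max_image (Finset.Icc 1 D) (diffCount A B)
    ⟨1, Finset.mem_Icc.2 ⟨le_rfl, hD⟩⟩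
  obtain ⟨hq1, hqD⟩ := Finset.mem_Icc.1 hqmem
  have hdiff : ∀ a ∈ A, ∀ b ∈ B, b - a ∈ Finset.Icc 1 D := fun a ha b hb => by
    have h1 := hlt a ha b hb
    have h2 := hA a ha
    have h3 := hB b hb
    rw [Finset.mem_Icc]; omega
  set M := diffCount A B q with hM
  have hmax : ∀ t, diffCount A B t ≤ M := by
    intro t
    by_cases ht : t ∈ Finset.Icc 1 D
    · exact hqmax t ht
    · have : diffCount A B t = 0 := by
        rw [diffCount, Finset.card_eq_zero, Finset.filter_eq_empty_iff]
        intro p' hp' heq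
        obtain ⟨h1, h2⟩ := Finset.mem_product.1 hp'
        apply ht
        have := hdiff _ h1 _ h2
        rwa [heq, Nat.add_sub_cancel_left] at this
      omega
  have hMD : p ^ 2 ≤ M * D := by
    have : (A ×ˢ B).card ≤ M * (Finset.Icc 1 D).card := by
      refine Finset.card_le_mul_card_image_of_maps_to (f := fun p' : ℕ × ℕ => p'.2 - p'.1)
        (fun p' hp' => hdiff _ (Finset.mem_product.1 hp').1 _ (Finset.mem_product.1 hp').2) M
        fun t _ => ?_
      refine (Finset.card_le_card fun p' hp' => ?_).trans (hmax t)
      obtain ⟨h1, h2⟩ := Finset.mem_filter.1 hp'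
      refine Finset.mem_filter.2 ⟨h1, ?_⟩
      have := hlt _ (Finset.mem_product.1 h1).1 _ (Finset.mem_product.1 h1).2
      omega
    rwa [Finset.card_product, hcA, hcB, ← sq, Nat.card_Icc, Nat.add_sub_cancel] at this
  have hKM : 268800 ≤ M := Nat.le_of_mul_le_mul_right (hp.trans hMD) hD
  set P := (A ×ˢ B).filter fun p' => p'.2 = p'.1 + q with hP
  have hPmem : ∀ p' ∈ P, p'.1 ∈ A ∧ p'.2 ∈ B ∧ p'.2 = p'.1 + q := fun p' hp' => by
    simpa [hP, and_assoc] using hp'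
  have hPM : P.card = M := rfl
  have hMp : M ≤ p := by
    rw [← hPM, ← hcA]
    refine Finset.card_le_card_of_injOn Prod.fst (fun p' hp' => (hPmem p' hp').1) ?_
    intro p' hp' p'' hp'' heq
    have h1 := (hPmem p' hp').2.2
    have h2 := (hPmem p'' hp'').2.2
    exact Prod.ext heq (by omega)
  have hDq : D ≤ 10 * q := by
    obtain ⟨p', hp'⟩ : P.Nonempty := Finset.card_pos.1 (by omega)
    obtain ⟨h1, h2, h3⟩ := hPmem p' hp'
    have := hsep _ h1 _ h2
    omega
  -- Half of the popular pairs build the progression of difference q; at least half of each group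
  -- stays free for the popular sums.
  obtain ⟨Q, hQP, hQc⟩ := Finset.exists_subset_card_eq (s := P) (n := M / 2) (by omega)
  have hQmem := fun p' hp' => hPmem p' (hQP hp')
  have hQ := fills_of_pairs hq1 Q (fun p' hp' => (hQmem p' hp').2.2)
    fun p' hp' p'' hp'' => hlt _ (hQmem p' hp').1 _ (hQmem p'' hp'').2.1
  set A' := A \ Q.image Prod.fst with hA'
  set B' := B \ Q.image Prod.snd with hB'
  have hA'A : A' ⊆ A := Finset.sdiff_subset
  have hB'B : B' ⊆ B := Finset.sdiff_subset
  have hlt' : ∀ a ∈ A', ∀ b ∈ B', a < b := fun a ha b hb => hlt a (hA'A ha) b (hB'B hb)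
  have hcA' : p ≤ 2 * A'.card := by
    have h1 := Finset.le_card_sdiff (Q.image Prod.fst) A
    have h2 := Finset.card_image_le (s := Q) (f := Prod.fst)
    rw [← hA'] at h1
    omega
  have hcB' : p ≤ 2 * B'.card := by
    have h1 := Finset.le_card_sdiff (Q.image Prod.snd) B
    have h2 := Finset.card_image_le (s := Q) (f := Prod.snd)
    rw [← hB'] at h1
    omega
  set N := M / 100 with hN
  have : NeZero q := ⟨by omega⟩
  obtain ⟨H, b, t₀, hcov, hW⟩ := exists_cover_of_layers (N := N) hlt'
    (fun a ha => hA a (hA'A ha)) (fun a ha => hB a (hB'B ha)) hDq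
  obtain ⟨d, hd0, hdH, hdq⟩ := exists_multiples_of_addSubgroup H
  have hlay := mul_card_mul_card_le_sum_layers hlt' (M := M) (N := N) (by omega)
    (Nat.div_le_self _ _)
    (fun t => (Finset.card_le_card (Finset.filter_subset_filter _
      (Finset.product_subset_product hA'A hB'B))).trans (hmax t))
    (Finset.range (2 * (x + D) + 1)) (fun a ha b hb => by
      have h1 := hA a (hA'A ha)
      have h2 := hB b (hB'B hb)
      rw [Finset.mem_range]; omega)
  set W := ∑ i ∈ Finset.range N, ((Finset.range (2 * (x + D) + 1)).filter
    fun s => 2 * i < sumCount A' B' s).card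
  set h := Nat.card H
  have hMN : M ≤ 200 * N := by omega
  have hpW : p ^ 2 ≤ 3200 * W := by
    have h1 : p ^ 2 ≤ 4 * (A'.card * B'.card) := by
      rw [sq]
      calc p * p ≤ (2 * A'.card) * (2 * B'.card) := Nat.mul_le_mul hcA' hcB'
        _ = _ := by ring
    refine Nat.le_of_mul_le_mul_left (c := N) ?_ (by omega)
    calc N * p ^ 2 ≤ N * (4 * (A'.card * B'.card)) := Nat.mul_le_mul_left _ h1
      _ = 4 * (N * (A'.card * B'.card)) := by ring
      _ ≤ 4 * (4 * M * W) := Nat.mul_le_mul_left _ hlay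
      _ ≤ 4 * (4 * (200 * N) * W) := by gcongr
      _ = N * (3200 * W) := by ring
  -- The constant 268800 = 84 · 3200 gives W ≥ 84D, and W ≤ 21(2q + Nh) with q ≤ D then leaves Nh ≥
  -- 2D. Since dh = q ≤ D, this forces 2d ≤ N.
  have hdN : d ≤ N := by
    have h1 : 2 * D ≤ N * h := by omega
    have h2 : d * (2 * D) ≤ N * D := by
      calc d * (2 * D) ≤ d * (N * h) := Nat.mul_le_mul_left _ h1
        _ = N * (d * h) := by ring
        _ ≤ N * D := Nat.mul_le_mul_left _ (hdq.le.trans hqD)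
    have h3 : d * 2 ≤ N := Nat.le_of_mul_le_mul_right (c := D) (by linarith) hD
    omega
  have hl : 5 * N * D ≤ Q.card * q := by
    rw [hQc]
    calc 5 * N * D ≤ 5 * N * (10 * q) := Nat.mul_le_mul_left _ hDq
      _ = (50 * N) * q := by ring
      _ ≤ M / 2 * q := Nat.mul_le_mul_right _ (by omega)
  have hND : 5 * N * D = 2 * N * D + 3 * N * D := by ring
  obtain ⟨c', hfin⟩ := hQ.refine (B := A' ∪ B') (T := 2 * N * D) (by
    have hAB := Finset.disjoint_left.2 fun a (ha : a ∈ A) (hb : a ∈ B) =>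
      lt_irrefl _ (hlt a ha a hb)
    have hQA : Q.image Prod.fst ⊆ A := Finset.image_subset_iff.2 fun p' hp' => (hQmem p' hp').1
    have hQB : Q.image Prod.snd ⊆ B := Finset.image_subset_iff.2 fun p' hp' => (hQmem p' hp').2.1
    rw [Finset.disjoint_union_left, Finset.disjoint_union_right, Finset.disjoint_union_right]
    exact ⟨⟨Finset.disjoint_sdiff, Finset.disjoint_of_subset_left hQA
      (Finset.disjoint_of_subset_right hB'B hAB)⟩, Finset.disjoint_of_subset_left hQB
      (Finset.disjoint_of_subset_right hA'A hAB.symm), Finset.disjoint_sdiff⟩) hdH hcov (by omega)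
  refine ⟨N, d, c', _, 3 * N * D, by omega, hd0, hdN, le_rfl, hfin.mono ?_ (by omega)⟩
  refine Finset.union_subset (Finset.union_subset ?_ ?_) (Finset.union_subset_union hA'A hB'B)
  · exact (Finset.image_subset_iff.2 fun p' hp' => (hQmem p' hp').1).trans
      Finset.subset_union_left
  · exact (Finset.image_subset_iff.2 fun p' hp' => (hQmem p' hp').2.1).trans
      Finset.subset_union_right

theorem modEq_of_cast_sub_mem {d d' : ℕ} {H : AddSubgroup (ZMod d)}
    (hH : ∀ x : ℤ, (x : ZMod d) ∈ H ↔ (d' : ℤ) ∣ x) {s t : ℕ} (h : (t : ZMod d) - s ∈ H) :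
    s ≡ t [MOD d'] := by
  rw [Nat.modEq_iff_dvd, ← hH]
  push_cast
  exact h

/-! ### Long and homogeneous progressions -/

/-- A set of `C √n` integers in `[1, n]` has a long arithmetic progression among its subset sums. -/
theorem exists_long_fills {n p : ℕ} (hn : 1 ≤ n) (hp : 268800 * n ≤ p ^ 2) {A : Finset ℕ}
    (hA : A ⊆ Finset.Icc 1 n) (hc : 8 * p ≤ A.card) :
    ∃ d c lo, 1 ≤ d ∧ d ≤ p ∧ Fills A d c lo (2 * (d * n)) := by
  classical
  have hp2 : 2 ≤ p := by
    by_contra! h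
    have : p ^ 2 ≤ 1 ^ 2 := Nat.pow_le_pow_left (by omega) 2
    omega
  obtain ⟨A₁, A₂, R, x, D, p', hA₁, hA₂, hR, h1R, h2R, hlt, hwin, hc₁, hc₂, hpp, hRc, hD, hKD,
    hsep⟩ := exists_separated 268800 (2 * p) (by norm_num) (by omega) p A 0 n
      (fun a ha => by have := Finset.mem_Icc.1 (hA ha); omega) hp (by omega)
  obtain ⟨N, d, c, lo, l, hN, hd, hdN, hl, hfill⟩ := exists_fills_of_separated (p := p')
    (fun a ha => hwin a (by simp [ha])) (fun a ha => hwin a (by simp [ha])) hc₁ hc₂ hlt hD hKD hsep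
  have : NeZero d := ⟨by omega⟩
  -- Sums stay within kD of each other, with k < d ≤ N, so a progression of length 3ND can afford
  -- the refinement and keep length at least D.
  obtain ⟨U, k, H, b, hUR, hkd, hUc, hUcov, hUrest⟩ := exists_absorbing d R x D
  obtain ⟨d', hd', hdH, hdd⟩ := exists_multiples_of_addSubgroup H
  have hd'd : d' ≤ d := Nat.le_of_dvd (by omega) ⟨_, hdd.symm⟩
  have hkD : k * D ≤ N * D := Nat.mul_le_mul_right _ (by omega)
  have hND : 3 * N * D = 3 * (N * D) := by ring
  have hND1 : D ≤ N * D := Nat.le_mul_of_pos_left _ (by omega)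
  obtain ⟨c', hfill'⟩ := hfill.refine (Finset.disjoint_of_subset_right hUR
    (Finset.disjoint_union_left.2 ⟨h1R, h2R⟩)) hdH hUcov (by omega)
  have hUs := Finset.card_sdiff_add_card_eq_card hUR
  obtain ⟨c'', lo'', hfin⟩ := Fills.exists_extend (x := x) (D := D) hd' (p / 2) _ (R \ U) _ _ _
    hfill' (Finset.disjoint_union_left.2 ⟨Finset.disjoint_of_subset_right Finset.sdiff_subset
      (Finset.disjoint_union_left.2 ⟨h1R, h2R⟩), Finset.disjoint_sdiff⟩) (by omega)
    (fun r hr => hwin r (by simp [Finset.sdiff_subset hr]))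
    (fun r hr r' hr' => by
      have h1 := hwin r (by simp [Finset.sdiff_subset hr])
      have h2 := hwin r' (by simp [Finset.sdiff_subset hr'])
      exact modEq_of_cast_sub_mem hdH (hUrest {r, r'}
        (Finset.insert_subset hr (Finset.singleton_subset_iff.2 hr')) Finset.card_le_two
        r (mem_subsetSums_of_mem (by simp)) r' (mem_subsetSums_of_mem (by simp))
        h1.1 h1.2 h2.1 h2.2)) (by omega)
  refine ⟨d', c'', lo'', hd', by omega, hfin.mono ?_ ?_⟩
  · exact Finset.union_subset (Finset.union_subset (Finset.union_subset hA₁ hA₂)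
      (hUR.trans hR)) (Finset.sdiff_subset.trans hR)
  · have h1 : p ^ 2 ≤ (4 * (p / 2)) ^ 2 := Nat.pow_le_pow_left (by omega) 2
    have h2 : 2 * n ≤ (p / 2) ^ 2 := by
      rw [mul_pow] at h1; omega
    have h3 := Nat.mul_le_mul_left d' h2
    have h4 : d' * (2 * n) = 2 * (d' * n) := by ring
    omega

theorem Fills.image_mul {E : Finset ℕ} {d e lo l : ℕ} (he : 0 < e) (h : Fills E d 0 lo l) :
    Fills (E.image (e * ·)) (e * d) 0 (e * lo) (e * l) := by
  intro z h1 h2 h3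
  obtain ⟨j, rfl⟩ := Nat.modEq_zero_iff_dvd.1 h3
  rw [mul_assoc] at h1 h2 ⊢
  obtain ⟨S, hS, hSs⟩ := h (d * j) (Nat.le_of_mul_le_mul_left h1 he)
    (Nat.le_of_mul_le_mul_left (by rwa [mul_add]) he) (Nat.modEq_zero_iff_dvd.2 ⟨j, rfl⟩)
  refine ⟨S.image (e * ·), Finset.image_subset_image hS, ?_⟩
  rw [Finset.sum_image fun a _ b _ hab => Nat.eq_of_mul_eq_mul_left he hab, ← Finset.mul_sum, hSs]

/-- A set of `C √n` integers in `[1, n]` has a homogeneous arithmetic progression of difference `d`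
among its subset sums, and most of the set consists of unused multiples of `d`. -/
theorem exists_homogeneous (n : ℕ) : ∀ A ⊆ Finset.Icc 1 n, 1 ≤ n →
    41520 * Real.sqrt n ≤ (A.card : ℝ) →
    ∃ (d lo l : ℕ) (E B : Finset ℕ), 1 ≤ d ∧ E ⊆ A ∧ B ⊆ A ∧ Disjoint E B ∧
      (A.card : ℝ) ≤ B.card + 41520 * Real.sqrt n ∧ (∀ b ∈ B, d ∣ b ∧ b ≤ l) ∧
      Fills E d 0 lo l := by
  classical
  induction n using Nat.strong_induction_on with
  | _ n ih =>
  intro A hA hn hc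
  have hs1 : (1 : ℝ) ≤ Real.sqrt n := by
    rw [Real.one_le_sqrt]; exact_mod_cast hn
  -- 519² ≥ 268800. A round uses 8p elements for `A₀` and at most 2p for U, so it loses at most 10p
  -- ≤ 10380√n, and 10380 / (1 - 0.75) = 41520.
  set p := 519 * (Nat.sqrt n + 1) with hp
  have hpR : (p : ℝ) ≤ 1038 * Real.sqrt n := by
    have h1 : ((Nat.sqrt n : ℕ) : ℝ) ≤ Real.sqrt n := Real.nat_sqrt_le_real_sqrt
    rw [hp]; push_cast; linarith
  have hpn : 268800 * n ≤ p ^ 2 := by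
    have := Nat.lt_succ_sqrt' n
    rw [hp, mul_pow]
    simp only [Nat.succ_eq_add_one] at this
    omega
  have h8 : 8 * p ≤ A.card := by
    have : ((8 * p : ℕ) : ℝ) ≤ A.card := by push_cast; linarith
    exact_mod_cast this
  obtain ⟨A₀, hA₀, hA₀c⟩ := Finset.exists_subset_card_eq h8
  obtain ⟨d, c, lo, hd, hdp, hfill⟩ := exists_long_fills hn hpn (hA₀.trans hA) hA₀c.ge
  have : NeZero d := ⟨by omega⟩
  obtain ⟨U, k, H, b, hUR, hkd, hUc, hUcov, hUrest⟩ := exists_absorbing d (A \ A₀) 0 n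
  obtain ⟨d', hd', hdH, -⟩ := exists_multiples_of_addSubgroup H
  have hkn : k * n ≤ d * n := Nat.mul_le_mul_right _ hkd.le
  obtain ⟨c', hfill'⟩ := hfill.refine (Finset.disjoint_of_subset_right hUR
    Finset.disjoint_sdiff) hdH hUcov (by omega)
  set R := (A \ A₀) \ U with hR
  have hRA : R ⊆ A := Finset.sdiff_subset.trans Finset.sdiff_subset
  have hRd : ∀ r ∈ R, d' ∣ r := fun r hr => by
    have h1 := Finset.mem_Icc.1 (hA (hRA hr))
    -- Comparing r with the empty sum 0 gives divisibility, not merely a common residue class.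
    have h2 := hUrest {r} (Finset.singleton_subset_iff.2 hr) (by simp) 0 (zero_mem_subsetSums _)
      r (mem_subsetSums_of_mem (by simp)) (by omega) (by omega) (by omega) (by omega)
    exact Nat.modEq_zero_iff_dvd.1 (modEq_of_cast_sub_mem hdH h2).symm
  have hRc : A.card ≤ R.card + 10 * p := by
    have h1 := Finset.card_sdiff_add_card_eq_card hA₀
    have h2 := Finset.card_sdiff_add_card_eq_card hUR
    rw [← hR] at h2
    omega
  have hRcR : (A.card : ℝ) ≤ R.card + 10380 * Real.sqrt n := by
    have : (A.card : ℝ) ≤ ((R.card + 10 * p : ℕ) : ℝ) := by exact_mod_cast hRc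
    push_cast at this
    linarith
  rcases Nat.lt_or_ge d' 2 with h2 | h2
  · obtain rfl : d' = 1 := by omega
    refine ⟨1, _, _, A₀ ∪ U, R, le_rfl, Finset.union_subset hA₀ (hUR.trans Finset.sdiff_subset),
      hRA, ?_, by linarith, fun b hb => ⟨one_dvd _, ?_⟩, fun z h1 h2 _ => hfill' z h1 h2 ?_⟩
    · exact Finset.disjoint_union_left.2 ⟨Finset.disjoint_of_subset_right Finset.sdiff_subset
        Finset.disjoint_sdiff, Finset.disjoint_sdiff⟩
    · have h1 := Finset.mem_Icc.1 (hA (hRA hb))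
      have h3 : n ≤ d * n := Nat.le_mul_of_pos_left _ hd
      omega
    · exact Nat.modEq_one
  · set A' := R.image (· / d') with hA'
    have hA'c : A'.card = R.card := Finset.card_image_of_injOn fun r hr r' hr' h =>
      (Nat.div_left_inj (hRd r hr) (hRd r' hr')).1 h
    have hmul : ∀ a ∈ A', d' * a ∈ R := fun a ha => by
      obtain ⟨r, hr, rfl⟩ := Finset.mem_image.1 ha
      rwa [Nat.mul_div_cancel' (hRd r hr)]
    have hA'n : A' ⊆ Finset.Icc 1 (n / d') := fun a ha => by
      have h1 := Finset.mem_Icc.1 (hA (hRA (hmul a ha)))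
      rw [Finset.mem_Icc, Nat.le_div_iff_mul_le hd', mul_comm]
      refine ⟨Nat.pos_of_ne_zero fun h => ?_, h1.2⟩
      rw [h] at h1
      omega
    have hsq : Real.sqrt ((n / d' : ℕ) : ℝ) ≤ 0.75 * Real.sqrt n := by
      rw [Real.sqrt_le_left (by positivity), mul_pow, Real.sq_sqrt (by positivity)]
      have h1 : 2 * (n / d') ≤ n :=
        (Nat.mul_le_mul_right _ h2).trans (Nat.mul_div_le n d')
      have : ((2 * (n / d') : ℕ) : ℝ) ≤ n := by exact_mod_cast h1
      push_cast at this
      linarith [(Nat.cast_nonneg n : (0 : ℝ) ≤ n)]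
    have hA'R : (A.card : ℝ) ≤ A'.card + 10380 * Real.sqrt n := by rw [hA'c]; exact hRcR
    have hn' : 1 ≤ n / d' := by
      have : A'.Nonempty := by
        rw [← Finset.card_pos]
        have : (0 : ℝ) < A'.card := by linarith
        exact_mod_cast this
      obtain ⟨a, ha⟩ := this
      have := Finset.mem_Icc.1 (hA'n ha)
      omega
    obtain ⟨e, lo', l', E, B, he, hE, hB, hEB, hcB, hBl, hfE⟩ :=
      ih (n / d') (Nat.div_lt_self hn h2) A' hA'n hn' (by linarith)
    have hinj : Function.Injective (d' * ·) := fun a b hab => Nat.eq_of_mul_eq_mul_left hd' hab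
    have himg : ∀ F ⊆ A', F.image (d' * ·) ⊆ A := fun F hF =>
      Finset.image_subset_iff.2 fun a ha => hRA (hmul a (hF ha))
    refine ⟨d' * e, d' * lo', d' * l', E.image (d' * ·), B.image (d' * ·), Nat.mul_pos hd' he,
      himg E hE, himg B hB, (Finset.disjoint_image hinj).2 hEB, ?_, ?_, hfE.image_mul hd'⟩
    · rw [Finset.card_image_of_injective _ hinj]
      linarith
    · intro b hb
      obtain ⟨b', hb', rfl⟩ := Finset.mem_image.1 hb
      exact ⟨Nat.mul_dvd_mul_left _ (hBl b' hb').1, Nat.mul_le_mul_left _ (hBl b' hb').2⟩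

/-- In increasing order the elements are at least d, 2d, 3d, and so on. -/
theorem mul_sq_le_two_mul_sum {d : ℕ} (hd : 0 < d) (k : ℕ) : ∀ B : Finset ℕ, B.card = k →
    (∀ b ∈ B, d ∣ b ∧ 0 < b) → d * k ^ 2 ≤ 2 * ∑ b ∈ B, b := by
  induction k with
  | zero => simp
  | succ k ih =>
    intro B hBc hB
    have hne : B.Nonempty := Finset.card_pos.1 (by omega)
    have hm := B.max'_mem hne
    have h1 := ih (B.erase (B.max' hne)) (by rw [Finset.card_erase_of_mem hm]; omega)
      fun b hb => hB b (Finset.mem_of_mem_erase hb)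
    obtain ⟨e, he⟩ := (hB _ hm).1
    have he0 : 0 < e := Nat.pos_of_ne_zero fun h => by
      have := (hB _ hm).2
      rw [he, h] at this
      omega
    have h2 := card_le_of_modEq hd B (m := d) (k := e - 1) (fun b hb => by
      refine ⟨Nat.le_of_dvd (hB b hb).2 (hB b hb).1, (B.le_max' b hb).trans ?_⟩
      rw [he, Nat.sub_mul, one_mul, mul_comm]
      omega)
      fun b hb b' hb' => (Nat.modEq_zero_iff_dvd.2 (hB b hb).1).trans
        (Nat.modEq_zero_iff_dvd.2 (hB b' hb').1).symm
    rw [← Finset.add_sum_erase B (fun b => b) hm]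
    have h3 : d * (k + 1) ≤ B.max' hne := by
      rw [he]
      exact Nat.mul_le_mul_left d (by omega)
    nlinarith

/-- At least 3√n unused multiples of d remain; appended to the progression, they add their total,
which is at least 3dn. -/
theorem exists_fills_zero {n : ℕ} (hn : 1 ≤ n) {A : Finset ℕ} (hA : A ⊆ Finset.Icc 1 n)
    (hc : 83040 * Real.sqrt n ≤ (A.card : ℝ)) :
    ∃ d lo, 1 ≤ d ∧ Fills A d 0 lo (3 * (d * n)) := by
  have hs : (0 : ℝ) ≤ Real.sqrt n := Real.sqrt_nonneg _
  obtain ⟨d, lo, l, E, B, hd, hE, hB, hEB, hcB, hBl, hfill⟩ :=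
    exists_homogeneous n A hA hn (by linarith)
  refine ⟨d, lo, hd, (hfill.union_of_dvd hEB hBl).mono (Finset.union_subset hE hB) ?_⟩
  have h1 := mul_sq_le_two_mul_sum hd _ B rfl fun b hb =>
    ⟨(hBl b hb).1, (Finset.mem_Icc.1 (hA (hB hb))).1⟩
  have h2 : 6 * n ≤ B.card ^ 2 := by
    have h3 : (3 : ℝ) * Real.sqrt n ≤ B.card := by linarith
    have h4 : (3 * Real.sqrt n) ^ 2 ≤ (B.card : ℝ) ^ 2 := by gcongr
    rw [mul_pow, Real.sq_sqrt (by positivity)] at h4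
    have h5 : ((6 * n : ℕ) : ℝ) ≤ ((B.card ^ 2 : ℕ) : ℝ) := by
      push_cast; linarith [(Nat.cast_nonneg n : (0 : ℝ) ≤ n)]
    exact_mod_cast h5
  have h3 := Nat.mul_le_mul_left d h2
  have h4 : d * (6 * n) = 6 * (d * n) := by ring
  omega

/-! ### Common subset sums -/

theorem HaveCommonSum.symm {A B : Finset ℕ} (h : HaveCommonSum A B) : HaveCommonSum B A :=
  let ⟨s, h0, h1, h2⟩ := h
  ⟨s, h0, h2, h1⟩

/-- A long homogeneous progression of subset sums of `A` meets the subset sums of any set `B` of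
larger total sum. -/
theorem Fills.haveCommonSum {A B : Finset ℕ} {n d lo : ℕ} (hn : 1 ≤ n) (hd : 1 ≤ d)
    (hA : Fills A d 0 lo (3 * (d * n))) (hB : B ⊆ Finset.Icc 1 n)
    (hAB : ∑ a ∈ A, a ≤ ∑ b ∈ B, b) : HaveCommonSum A B := by
  classical
  obtain ⟨S, hS, hmax⟩ := Finset.exists_max_image
    (B.powerset.filter fun S => d ∣ ∑ s ∈ S, s ∧ ∑ s ∈ S, s ≤ lo + 3 * (d * n)) Finset.card
    ⟨∅, by simp⟩
  obtain ⟨hSB, hSd, hSle⟩ := Finset.mem_filter.1 hS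
  rw [Finset.mem_powerset] at hSB
  -- Nonemptiness excludes the sum 0, which would otherwise qualify when `lo` = 0.
  by_cases hdone : S.Nonempty ∧ lo ≤ ∑ s ∈ S, s
  · refine ⟨∑ s ∈ S, s, ?_, hA _ hdone.2 hSle (Nat.modEq_zero_iff_dvd.2 hSd), S, hSB, rfl⟩
    obtain ⟨s, hs⟩ := hdone.1
    have h1 := Finset.single_le_sum (f := fun x : ℕ => x) (fun _ _ => Nat.zero_le _) hs
    have h2 := Finset.mem_Icc.1 (hB (hSB hs))
    omega
  exfalso
  have hSlo : ∑ s ∈ S, s ≤ lo := by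
    rw [not_and_or] at hdone
    rcases hdone with h | h
    · rw [Finset.not_nonempty_iff_eq_empty.1 h]; simp
    · omega
  -- From a sum of at most `lo`, a d-element zero-sum subset adds at most dn and stays below the
  -- upper limit, so it would enlarge S.
  have hrest : (B \ S).card < 2 * d - 1 := by
    by_contra! hge
    obtain ⟨T, hT, hTc, hTd⟩ := Int.erdos_ginzburg_ziv (s := B \ S) (n := d)
      (fun b : ℕ => (b : ℤ)) hge
    have hTd' : d ∣ ∑ t ∈ T, t := by
      rw [← Int.natCast_dvd_natCast, Nat.cast_sum]
      exact hTd
    have hdisj : Disjoint S T := Finset.disjoint_of_subset_right hT Finset.disjoint_sdiff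
    have hTn := Finset.sum_le_card_nsmul T (fun t => t) n fun t ht =>
      (Finset.mem_Icc.1 (hB (Finset.sdiff_subset (hT ht)))).2
    rw [smul_eq_mul, hTc] at hTn
    have := hmax (S ∪ T) (Finset.mem_filter.2 ⟨Finset.mem_powerset.2 (Finset.union_subset hSB
      (hT.trans Finset.sdiff_subset)), by
        rw [Finset.sum_union hdisj]; exact ⟨dvd_add hSd hTd', by omega⟩⟩)
    rw [Finset.card_union_of_disjoint hdisj, hTc] at this
    omega
  have hBsum : ∑ b ∈ B, b + 2 * n ≤ lo + 2 * (d * n) := by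
    rw [← Finset.sum_sdiff hSB]
    have h1 := Finset.sum_le_card_nsmul (B \ S) (fun t => t) n fun t ht =>
      (Finset.mem_Icc.1 (hB (Finset.sdiff_subset ht))).2
    rw [smul_eq_mul] at h1
    have h2 : ((B \ S).card + 2) * n ≤ (2 * d) * n := Nat.mul_le_mul_right n (by omega)
    rw [add_mul, mul_assoc] at h2
    omega
  have h1 := Nat.div_add_mod (lo + 3 * (d * n)) d
  have h2 := Nat.mod_lt (lo + 3 * (d * n)) hd
  have h3 : d ≤ d * n := Nat.le_mul_of_pos_right _ hn
  -- The last multiple of d in the progression exceeds `lo` + 2dn - 1, yet is at most the total of A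
  -- and hence that of B, against `hBsum`.
  have h4 := le_sum_of_mem_subsetSums (hA (d * ((lo + 3 * (d * n)) / d)) (by omega) (by omega)
    (Nat.modEq_zero_iff_dvd.2 ⟨_, rfl⟩))
  omega

theorem haveCommonSum_of_card {n : ℕ} (hn : 1 ≤ n) {A B : Finset ℕ} (hA : A ⊆ Finset.Icc 1 n)
    (hB : B ⊆ Finset.Icc 1 n) (hcA : 83040 * Real.sqrt n ≤ (A.card : ℝ))
    (hcB : 83040 * Real.sqrt n ≤ (B.card : ℝ)) : HaveCommonSum A B := by
  rcases le_total (∑ a ∈ A, a) (∑ b ∈ B, b) with h | h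
  · obtain ⟨d, lo, hd, hfill⟩ := exists_fills_zero hn hA hcA
    exact hfill.haveCommonSum hn hd hB h
  · obtain ⟨d, lo, hd, hfill⟩ := exists_fills_zero hn hB hcB
    exact (hfill.haveCommonSum hn hd hA h).symm

theorem bigH_le {n : ℕ} (hn : 1 ≤ n) : (bigH n : ℝ) ≤ 83040 * Real.sqrt n := by
  obtain ⟨A, B, hA, hB, hcA, hcB, hno⟩ := (isGreatest_bigH n).1
  by_contra! h
  exact hno (haveCommonSum_of_card hn hA hB (by rw [hcA]; exact h.le) (by rw [hcB]; exact h.le))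

/-! ### Non-averaging sets -/

/-- **Straus' inequality.** -/
theorem smallH_le (n : ℕ) : smallH n ≤ 2 * bigH n + 2 := by
  classical
  obtain ⟨A, hA, hc, hav⟩ := (isGreatest_smallH n).1
  rw [← hc]
  rcases Nat.eq_zero_or_pos A.card with h0 | h0
  · omega
  -- There are k elements below a median a and at least k above it; rounding down costs the additive
  -- 2.
  obtain ⟨k, hk⟩ : ∃ k, k = (A.card - 1) / 2 := ⟨_, rfl⟩
  obtain ⟨L, hL, hLc, hlt⟩ := exists_subset_card_lt (A := A) k (by omega)
  have hLs := Finset.card_sdiff_add_card_eq_card hL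
  have hne : (A \ L).Nonempty := Finset.card_pos.1 (by omega)
  obtain ⟨a, ha⟩ : ∃ a, a = (A \ L).min' hne := ⟨_, rfl⟩
  have haAL : a ∈ A \ L := ha ▸ Finset.min'_mem _ _
  obtain ⟨haA, haL⟩ := Finset.mem_sdiff.1 haAL
  obtain ⟨G, hG, hGc⟩ := Finset.exists_subset_card_eq (s := (A \ L).erase a) (n := k)
    (by rw [Finset.card_erase_of_mem haAL]; omega)
  have hLa : ∀ x ∈ L, x < a := fun x hx => hlt x hx a haAL
  have hGa : ∀ x ∈ G, a < x := fun x hx => by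
    have h1 := Finset.mem_erase.1 (hG hx)
    have h2 := (A \ L).min'_le x h1.2
    rw [← ha] at h2
    exact lt_of_le_of_ne h2 (Ne.symm h1.1)
  have hGA : G ⊆ A := fun x hx => Finset.sdiff_subset (Finset.mem_of_mem_erase (hG hx))
  have hbd : ∀ x ∈ A, 1 ≤ x ∧ x ≤ n := fun x hx => Finset.mem_Icc.1 (hA hx)
  have hinjL : Set.InjOn (fun x => a - x) (L : Set ℕ) := fun x hx y hy hxy => by
    have h1 := hLa x hx
    have h2 := hLa y hy
    simp only at hxy
    omega
  have hinjG : Set.InjOn (fun x => x - a) (G : Set ℕ) := fun x hx y hy hxy => by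
    have h1 := hGa x hx
    have h2 := hGa y hy
    simp only at hxy
    omega
  have hmem : k ∈ disjointSumSizes n := by
    refine ⟨L.image fun x => a - x, G.image fun x => x - a, ?_, ?_,
      by rw [Finset.card_image_of_injOn hinjL, hLc],
      by rw [Finset.card_image_of_injOn hinjG, hGc], ?_⟩
    · refine Finset.image_subset_iff.2 fun x hx => Finset.mem_Icc.2 ?_
      have h1 := hLa x hx
      have h2 := hbd a haA
      omega
    · refine Finset.image_subset_iff.2 fun x hx => Finset.mem_Icc.2 ?_
      have h1 := hGa x hx
      have h2 := hbd x (hGA hx)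
      omega
    · rintro ⟨s, hs0, ⟨S, hS, hSs⟩, T, hT, hTs⟩
      obtain ⟨S, hSL, rfl⟩ := Finset.subset_image_iff.1 hS
      obtain ⟨T, hTG, rfl⟩ := Finset.subset_image_iff.1 hT
      have hSL' : S ⊆ L := by exact_mod_cast hSL
      have hTG' : T ⊆ G := by exact_mod_cast hTG
      rw [Finset.sum_image fun x hx y hy => hinjL (hSL' hx) (hSL' hy)] at hSs
      rw [Finset.sum_image fun x hx y hy => hinjG (hTG' hx) (hTG' hy)] at hTs
      have hSne : S.Nonempty := Finset.nonempty_of_sum_ne_zero (hSs ▸ hs0)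
      have hTne : T.Nonempty := Finset.nonempty_of_sum_ne_zero (hTs ▸ hs0)
      have hdisj : Disjoint S T := Finset.disjoint_left.2 fun x hx hx' =>
        lt_asymm (hLa x (hSL' hx)) (hGa x (hTG' hx'))
      have hcard : (S ∪ T).card = S.card + T.card := Finset.card_union_of_disjoint hdisj
      have h1 := hSne.card_pos
      have h2 := hTne.card_pos
      -- Equal sums of distances below and above a mean that a is the average of S ∪ T.
      have hSq : (s : ℚ) = S.card * a - ∑ x ∈ S, (x : ℚ) := by
        rw [← hSs, Nat.cast_sum, Finset.sum_congr rfl fun x hx =>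
          Nat.cast_sub (hLa x (hSL' hx)).le, Finset.sum_sub_distrib, Finset.sum_const,
          nsmul_eq_mul]
      have hTq : (s : ℚ) = ∑ x ∈ T, (x : ℚ) - T.card * a := by
        rw [← hTs, Nat.cast_sum, Finset.sum_congr rfl fun x hx =>
          Nat.cast_sub (hGa x (hTG' hx)).le, Finset.sum_sub_distrib, Finset.sum_const,
          nsmul_eq_mul]
      refine hav a haA ⟨S ∪ T, ?_, by omega, ?_⟩
      · refine Finset.union_subset (fun x hx => Finset.mem_erase.2 ⟨?_, hL (hSL' hx)⟩)
          fun x hx => Finset.mem_erase.2 ⟨?_, hGA (hTG' hx)⟩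
        · exact (hLa x (hSL' hx)).ne
        · exact (hGa x (hTG' hx)).ne'
      · have hpos : (0 : ℚ) < ((S ∪ T).card : ℚ) := by exact_mod_cast (by omega)
        rw [eq_div_iff hpos.ne', Finset.sum_union hdisj, hcard]
        push_cast
        linarith
  have := (isGreatest_bigH n).2 hmem
  omega

end NonAveraging

theorem mainTheorem10 :
    ∃ C : ℝ, 0 < C ∧
      (∀ n : ℕ, 1 ≤ n → ∀ A B : Finset ℕ, A ⊆ Finset.Icc 1 n → B ⊆ Finset.Icc 1 n →
        C * Real.sqrt (n : ℝ) ≤ (A.card : ℝ) → C * Real.sqrt (n : ℝ) ≤ (B.card : ℝ) →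
          NonAveraging.HaveCommonSum A B) ∧
      (∀ n : ℕ, 1 ≤ n → (NonAveraging.bigH n : ℝ) ≤ C * Real.sqrt (n : ℝ)) ∧
      (∀ n : ℕ, 1 ≤ n → NonAveraging.smallH n ≤ 2 * NonAveraging.bigH n + 2) ∧
      (∀ n : ℕ, 1 ≤ n → (NonAveraging.smallH n : ℝ) ≤ C * Real.sqrt (n : ℝ)) := by
  have hs : ∀ n : ℕ, 1 ≤ n → (1 : ℝ) ≤ Real.sqrt n := fun n hn => by
    rw [Real.one_le_sqrt]; exact_mod_cast hn
  -- 166082 = 2 · 83040 + 2, with the additive 2 of Straus' inequality absorbed by √n ≥ 1.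
  refine ⟨166082, by norm_num, fun n hn A B hA hB hcA hcB => ?_, fun n hn => ?_,
    fun n _ => NonAveraging.smallH_le n, fun n hn => ?_⟩
  · have := hs n hn
    exact NonAveraging.haveCommonSum_of_card hn hA hB (by linarith) (by linarith)
  · have := hs n hn
    linarith [NonAveraging.bigH_le hn]
  · have h1 := hs n hn
    have h2 := NonAveraging.bigH_le hn
    have h3 : (NonAveraging.smallH n : ℝ) ≤ ((2 * NonAveraging.bigH n + 2 : ℕ) : ℝ) := by
      exact_mod_cast NonAveraging.smallH_le n
    push_cast at h3
    linarith
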